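/- **Types and data.** Fix finitely many declarations $\mathbf{data}\ \tau_k=\mu t.\,F_k(t)$, where $F_k(t)$ is built from $t$, $\mathbf{unit}$ and earlier declared types by $+$ and $\times$. Each declaration introduces a normal data type $\tau_k$ and a safe copy $\tau_k^{s}$. Types are built from $\mathbf{unit}$ and these data types by $+,\times,\to$; ground types contain no $\to$. Normal (safe) ground types are those built by $+,\times$ from $\mathbf{unit}$ and normal (safe) data types only. For a normal ground type $\sigma$, $\sigma^{s}$ replaces each data type in it by its safe copy. For a type $\sigma$, $F_k\sigma$ is $F_k(t)$ with $t$ replaced by $\sigma$, and $F_k^{s}\sigma$ is the same with the declared types named in $F_k$ replaced by their safe copies. **Terms and typing ($\mathit{RS}^-_1$).** The terms are those of the simply typed $\lambda$-calculus with $()$, pairs, projections, injections and case, with the usual typing rules, except that $(e_1,e_2):\sigma_1\times\sigma_2$ and $\iota_i e:\sigma_1+\sigma_2$ require $\sigma_1,\sigma_2$ to be both normal ground types or both safe ground types. In addition there are constructors $c_k:F_k\tau_k\to\tau_k$, $c^{s}_k:F^{s}_k\tau^{s}_k\to\tau^{s}_k$ and their inverse destructors; the recursor, $\Gamma\vdash\mathrm{fold}_k\,f\,e:\sigma$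 if $\sigma$ is a safe ground type, $\Gamma\vdash e:\tau_k$, and $\Gamma\vdash f:F_k\sigma\to\sigma$ or $\Gamma\vdash f:F_k^{s}\sigma\to\sigma$; and the rule *lower*: if $\sigma$ is a normal ground type, $\Gamma\vdash e:\sigma^{s}$ and $\mathrm{sfv}(e)=\emptyset$, then $\Gamma\vdash e:\sigma$. Here $\mathrm{sfv}(e)$ is the set of free variables $x$ of $e$ for which $\Gamma(x)$ is safe, in the sense that $\Gamma(x)=\sigma_1\to\dots\to\sigma_m\to\rho$ $(m\ge 0)$ with $\rho$ not an arrow type and a safe data type occurring in $\rho$ (where an arrow type inside a sum or product counts by its result type only). **Evaluation and size.** Evaluation is call by value, in an environment $\theta$. Each application of a constructor of a data type allocates a fresh data cons-cell storing the value of the argument, so values are represented by dags with sharing. Folds satisfy $\mathrm{fold}_k f\,(c_k v)=f(F_k(\mathrm{fold}_k f)\,v)$ and are memoized: within one fold, the result for each cons-cell is computed once, stored, and reused. An environment for $\Gamma\vdash e:\tau$ gives each free variable $x$ of $e$ a value of type $\Gamma(x)$, all represented in a common heap. For variables $y_1,\dots,y_m$ of ground type, $|y_1,\dots,y_m|\theta$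 is the number of distinct data cons-cells in the representation of their values, shared cells being counted once; $|e|\theta$ is that number for the value of $e$ in $\theta$. **Theorem.** There is a partial recursive procedure that, for every derivable $\mathit{RS}^-_1$ judgment $\Gamma\vdash e:\tau$ (over given data declarations) in which $\tau$ is a ground type and each type in $\Gamma$ is a normal or a safe ground type, outputs a polynomial $p$ with natural-number coefficients, whose variables are among the sizes $|x|$ of those $x\in\mathrm{fv}(e)$ for which $\Gamma(x)$ is normal, such that for every environment $\theta$ for $\Gamma\vdash e:\tau$ the term $e$ has a value of type $\tau$ in $\theta$ and $$|e|\theta\ \le\ p\theta+|\mathrm{sfv}(e)|\theta .$$ -/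

import Mathlib

namespace RS

/-! Types and data declarations -/

/-- Each declared data type comes in a normal copy and a safe copy. -/
inductive Mode where
  | normal
  | safe

/-- Simple types over `unit`, the normal data types `data normal k` and the safe data types
`data safe k`, where `k` is the position of the declaration of the data type. -/
inductive Ty where
  | unit
  | data (m : Mode) (k : ℕ)
  | sum (σ τ : Ty)
  | prod (σ τ : Ty)
  | arrow (σ τ : Ty)

/-- Right-hand sides of data declarations `data τ = μ t. F`: ground types built from the bound
variable `t` (here `self`), `unit`, and other data types. -/
inductive PolyFunctor where
  | self
  | unit
  | data (j : ℕ)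
  | sum (F G : PolyFunctor)
  | prod (F G : PolyFunctor)

/-- `F.inst m σ` puts `σ` for `self` and takes the data types named in `F` in mode `m`. -/
def PolyFunctor.inst (m : Mode) (σ : Ty) : PolyFunctor → Ty
  | .self => σ
  | .unit => .unit
  | .data j => .data m j
  | .sum F G => .sum (F.inst m σ) (G.inst m σ)
  | .prod F G => .prod (F.inst m σ) (G.inst m σ)

/-- All data types named in the functor are among the first `k` declared ones. -/
def PolyFunctor.Below (k : ℕ) : PolyFunctor → Prop
  | .self => True
  | .unit => True
  | .data j => j < k
  | .sum F G => F.Below k ∧ G.Below k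
  | .prod F G => F.Below k ∧ G.Below k

/-- A sequence of data declarations, each of which may only use the earlier ones. -/
def WfDecls (S : List PolyFunctor) : Prop :=
  ∀ (k : ℕ) (F : PolyFunctor), S[k]? = some F → F.Below k

/-- Ground types are the types of level `0`, that is, those without `→`. -/
def Ty.isGround : Ty → Bool
  | .unit => true
  | .data _ _ => true
  | .sum σ τ => σ.isGround && τ.isGround
  | .prod σ τ => σ.isGround && τ.isGround
  | .arrow _ _ => false

/-- Normal ground types. -/
def Ty.isNormal : Ty → Bool
  | .unit => true
  | .data .normal _ => true
  | .data .safe _ => false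
  | .sum σ τ => σ.isNormal && τ.isNormal
  | .prod σ τ => σ.isNormal && τ.isNormal
  | .arrow _ _ => false

/-- Safe ground types. -/
def Ty.isSafe : Ty → Bool
  | .unit => true
  | .data .normal _ => false
  | .data .safe _ => true
  | .sum σ τ => σ.isSafe && τ.isSafe
  | .prod σ τ => σ.isSafe && τ.isSafe
  | .arrow _ _ => false

/-- The safe version of a type: every normal data type is replaced by its safe copy.
(It is used for normal ground types only.) -/
def Ty.toSafe : Ty → Ty
  | .unit => .unit
  | .data _ k => .data .safe k
  | .sum σ τ => .sum σ.toSafe τ.toSafe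
  | .prod σ τ => .prod σ.toSafe τ.toSafe
  | .arrow σ τ => .arrow σ τ

/-- The type can deliver safe data.  For a ground type: a safe data type occurs in it; thus a
safe ground type has the property unless it is built from `unit` alone (such values hold no data),
and a normal ground type does not have it.  A function type has it when its result type does. -/
def Ty.deliversSafe : Ty → Bool
  | .unit => false
  | .data .normal _ => false
  | .data .safe _ => true
  | .sum σ τ => σ.deliversSafe || τ.deliversSafe
  | .prod σ τ => σ.deliversSafe || τ.deliversSafe
  | .arrow _ τ => τ.deliversSafe

/-! Terms and typing -/

/-- Raw terms, with de Bruijn indices for variables.  `lam` binds one variable, and so does each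
branch of `case`.  `con m k` and `des m k` are the constructor and the destructor of
`data m k`, and `fold k` is the recursor on `data normal k`. -/
inductive Tm where
  | var (i : ℕ)
  | lam (e : Tm)
  | app (e₁ e₂ : Tm)
  | unit
  | pair (e₁ e₂ : Tm)
  | fst (e : Tm)
  | snd (e : Tm)
  | inl (e : Tm)
  | inr (e : Tm)
  | case (e e₁ e₂ : Tm)
  | con (m : Mode) (k : ℕ) (e : Tm)
  | des (m : Mode) (k : ℕ) (e : Tm)
  | fold (k : ℕ) (f e : Tm)

/-- Remove the variable `0` and shift the others down. -/
def unbind (s : Finset ℕ) : Finset ℕ := (s.erase 0).image Nat.pred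

/-- Free variables. -/
def Tm.fv : Tm → Finset ℕ
  | .var i => {i}
  | .lam e => unbind e.fv
  | .app e₁ e₂ => e₁.fv ∪ e₂.fv
  | .unit => ∅
  | .pair e₁ e₂ => e₁.fv ∪ e₂.fv
  | .fst e => e.fv
  | .snd e => e.fv
  | .inl e => e.fv
  | .inr e => e.fv
  | .case e e₁ e₂ => e.fv ∪ (unbind e₁.fv ∪ unbind e₂.fv)
  | .con _ _ e => e.fv
  | .des _ _ e => e.fv
  | .fold _ f e => f.fv ∪ e.fv

/-- The free variables of `e` of safe type (for function types: with safe results). -/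
def sfv (Γ : List Ty) (e : Tm) : Finset ℕ :=
  e.fv.filter fun x => (Γ[x]?).any Ty.deliversSafe

/-- The free variables of `e` of normal type. -/
def nfv (Γ : List Ty) (e : Tm) : Finset ℕ :=
  e.fv.filter fun x => (Γ[x]?).any Ty.isNormal

/-- Side condition on pairing and injections: both component types are normal ground types, or
both are safe ground types. -/
def SameSort (σ τ : Ty) : Prop :=
  (σ.isNormal ∧ τ.isNormal) ∨ (σ.isSafe ∧ τ.isSafe)

/-- The typing judgments `Γ ⊢ e : τ` for the data declarations `S`. -/
inductive HasType (S : List PolyFunctor) : List Ty → Tm → Ty → Prop where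
  | var {Γ : List Ty} {i : ℕ} {τ : Ty} :
      Γ[i]? = some τ → HasType S Γ (.var i) τ
  | lam {Γ : List Ty} {e : Tm} {σ τ : Ty} :
      HasType S (σ :: Γ) e τ → HasType S Γ (.lam e) (.arrow σ τ)
  | app {Γ : List Ty} {e₁ e₂ : Tm} {σ τ : Ty} :
      HasType S Γ e₁ (.arrow σ τ) → HasType S Γ e₂ σ → HasType S Γ (.app e₁ e₂) τ
  | unit {Γ : List Ty} :
      HasType S Γ .unit .unit
  | pair {Γ : List Ty} {e₁ e₂ : Tm} {σ τ : Ty} :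
      HasType S Γ e₁ σ → HasType S Γ e₂ τ → SameSort σ τ →
      HasType S Γ (.pair e₁ e₂) (.prod σ τ)
  | fst {Γ : List Ty} {e : Tm} {σ τ : Ty} :
      HasType S Γ e (.prod σ τ) → HasType S Γ (.fst e) σ
  | snd {Γ : List Ty} {e : Tm} {σ τ : Ty} :
      HasType S Γ e (.prod σ τ) → HasType S Γ (.snd e) τ
  | inl {Γ : List Ty} {e : Tm} {σ τ : Ty} :
      HasType S Γ e σ → SameSort σ τ → HasType S Γ (.inl e) (.sum σ τ)
  | inr {Γ : List Ty} {e : Tm} {σ τ : Ty} :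
      HasType S Γ e τ → SameSort σ τ → HasType S Γ (.inr e) (.sum σ τ)
  | case {Γ : List Ty} {e e₁ e₂ : Tm} {σ₁ σ₂ τ : Ty} :
      HasType S Γ e (.sum σ₁ σ₂) → HasType S (σ₁ :: Γ) e₁ τ → HasType S (σ₂ :: Γ) e₂ τ →
      HasType S Γ (.case e e₁ e₂) τ
  | con {Γ : List Ty} {m : Mode} {k : ℕ} {F : PolyFunctor} {e : Tm} :
      S[k]? = some F → HasType S Γ e (F.inst m (.data m k)) →
      HasType S Γ (.con m k e) (.data m k)
  | des {Γ : List Ty} {m : Mode} {k : ℕ} {F : PolyFunctor} {e : Tm} :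
      S[k]? = some F → HasType S Γ e (.data m k) →
      HasType S Γ (.des m k e) (F.inst m (.data m k))
  /-- Ramified recursion: it is driven by normal data and its result type is a safe ground type.
  The data that the folded cells hold besides the recursive results may be offered to `f`
  as normal data (`m = normal`) or as safe data (`m = safe`). -/
  | fold {Γ : List Ty} {m : Mode} {k : ℕ} {F : PolyFunctor} {f e : Tm} {σ : Ty} :
      S[k]? = some F → σ.isSafe → HasType S Γ f (.arrow (F.inst m σ) σ) →
      HasType S Γ e (.data .normal k) → HasType S Γ (.fold k f e) σ
  | lower {Γ : List Ty} {e : Tm} {τ : Ty} :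
      τ.isNormal → HasType S Γ e τ.toSafe → sfv Γ e = ∅ → HasType S Γ e τ

/-! Values and their representation -/

/-- Values.  `cell k a v` is a reference to the data cons-cell at address `a`, made by a
constructor of the `k`-th data type and storing `v`; a value is thus the unfolding of a dag, with
every data cons-cell labelled by its address, and occurrences of one address are occurrences of
one shared cell.  Safe and normal data have the same representation, as lowering a safe
term to a normal type leaves its value alone. -/
inductive Val where
  | unit
  | inl (v : Val)
  | inr (v : Val)
  | pair (v w : Val)
  | cell (k a : ℕ) (v : Val)
  | clo (e : Tm) (θ : List Val)

/-- The addresses of the data cons-cells in the representation of a value of ground type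
(such a value contains no closure). -/
def Val.cells : Val → Finset ℕ
  | .unit => ∅
  | .inl v => v.cells
  | .inr v => v.cells
  | .pair v w => v.cells ∪ w.cells
  | .cell _ a v => insert a v.cells
  | .clo _ _ => ∅

/-- `v.Holds k a w`: the cell at address `a`, made by a constructor of the `k`-th data type and
storing `w`, occurs in the representation of `v`. -/
def Val.Holds : Val → ℕ → ℕ → Val → Prop
  | .unit, _, _, _ => False
  | .inl v, k, a, w => v.Holds k a w
  | .inr v, k, a, w => v.Holds k a w
  | .pair v₁ v₂, k, a, w => v₁.Holds k a w ∨ v₂.Holds k a w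
  | .cell j b v, k, a, w => (j = k ∧ b = a ∧ v = w) ∨ v.Holds k a w
  | .clo _ _, _, _, _ => False

/-- The values of ground type. -/
inductive Val.HasTy (S : List PolyFunctor) : Val → Ty → Prop where
  | unit : Val.HasTy S .unit .unit
  | inl {v : Val} {σ τ : Ty} : Val.HasTy S v σ → Val.HasTy S (.inl v) (.sum σ τ)
  | inr {v : Val} {σ τ : Ty} : Val.HasTy S v τ → Val.HasTy S (.inr v) (.sum σ τ)
  | pair {v w : Val} {σ τ : Ty} :
      Val.HasTy S v σ → Val.HasTy S w τ → Val.HasTy S (.pair v w) (.prod σ τ)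
  | cell {m : Mode} {k a : ℕ} {F : PolyFunctor} {v : Val} :
      S[k]? = some F → Val.HasTy S v (F.inst m (.data m k)) →
      Val.HasTy S (.cell k a v) (.data m k)

/-! Evaluation -/

mutual

/-- `Eval S θ e n v n₁`: the closure of `e` with the environment `θ` evaluates (call by value) to
`v`, where `n` is the first unused address before the evaluation and `n₁` the one after it. -/
inductive Eval (S : List PolyFunctor) : List Val → Tm → ℕ → Val → ℕ → Prop where
  | var {θ : List Val} {i n : ℕ} {v : Val} :
      θ[i]? = some v → Eval S θ (.var i) n v n
  | lam {θ : List Val} {e : Tm} {n : ℕ} :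
      Eval S θ (.lam e) n (.clo e θ) n
  | app {θ θ₀ : List Val} {e₁ e₂ e : Tm} {v w : Val} {n n₁ n₂ n₃ : ℕ} :
      Eval S θ e₁ n (.clo e θ₀) n₁ → Eval S θ e₂ n₁ v n₂ → Eval S (v :: θ₀) e n₂ w n₃ →
      Eval S θ (.app e₁ e₂) n w n₃
  | unit {θ : List Val} {n : ℕ} :
      Eval S θ .unit n .unit n
  | pair {θ : List Val} {e₁ e₂ : Tm} {v w : Val} {n n₁ n₂ : ℕ} :
      Eval S θ e₁ n v n₁ → Eval S θ e₂ n₁ w n₂ → Eval S θ (.pair e₁ e₂) n (.pair v w) n₂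
  | fst {θ : List Val} {e : Tm} {v w : Val} {n n₁ : ℕ} :
      Eval S θ e n (.pair v w) n₁ → Eval S θ (.fst e) n v n₁
  | snd {θ : List Val} {e : Tm} {v w : Val} {n n₁ : ℕ} :
      Eval S θ e n (.pair v w) n₁ → Eval S θ (.snd e) n w n₁
  | inl {θ : List Val} {e : Tm} {v : Val} {n n₁ : ℕ} :
      Eval S θ e n v n₁ → Eval S θ (.inl e) n (.inl v) n₁
  | inr {θ : List Val} {e : Tm} {v : Val} {n n₁ : ℕ} :
      Eval S θ e n v n₁ → Eval S θ (.inr e) n (.inr v) n₁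
  | case_inl {θ : List Val} {e e₁ e₂ : Tm} {v w : Val} {n n₁ n₂ : ℕ} :
      Eval S θ e n (.inl v) n₁ → Eval S (v :: θ) e₁ n₁ w n₂ →
      Eval S θ (.case e e₁ e₂) n w n₂
  | case_inr {θ : List Val} {e e₁ e₂ : Tm} {v w : Val} {n n₁ n₂ : ℕ} :
      Eval S θ e n (.inr v) n₁ → Eval S (v :: θ) e₂ n₁ w n₂ →
      Eval S θ (.case e e₁ e₂) n w n₂
  | con {θ : List Val} {m : Mode} {k : ℕ} {e : Tm} {v : Val} {n n₁ : ℕ} :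
      Eval S θ e n v n₁ → Eval S θ (.con m k e) n (.cell k n₁ v) (n₁ + 1)
  | des {θ : List Val} {m : Mode} {k a : ℕ} {e : Tm} {v : Val} {n n₁ : ℕ} :
      Eval S θ e n (.cell k a v) n₁ → Eval S θ (.des m k e) n v n₁
  /-- Each fold starts with an empty memo table. -/
  | fold {θ : List Val} {k : ℕ} {f e : Tm} {t r : Val} {n n₁ n₂ : ℕ} {M : List (ℕ × Val)} :
      Eval S θ e n t n₁ → FoldCell S θ k f [] n₁ t r M n₂ → Eval S θ (.fold k f e) n r n₂

/-- `FoldCell S θ k f M n t r M₁ n₁`: folding `f` (in the environment `θ`) over the datum `t` of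
the `k`-th data type gives `r`.  The memo table, which maps the addresses of the cells that are
done to their results, is `M` before and `M₁` after. -/
inductive FoldCell (S : List PolyFunctor) : List Val → ℕ → Tm → List (ℕ × Val) → ℕ → Val →
    Val → List (ℕ × Val) → ℕ → Prop where
  | hit {θ : List Val} {k a n : ℕ} {f : Tm} {M : List (ℕ × Val)} {v r : Val} :
      M.lookup a = some r → FoldCell S θ k f M n (.cell k a v) r M n
  | miss {θ θ₀ : List Val} {k a n n₁ n₂ n₃ : ℕ} {F : PolyFunctor} {f e : Tm}
      {M M₁ : List (ℕ × Val)} {v w r : Val} :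
      M.lookup a = none → S[k]? = some F → Eval S θ f n (.clo e θ₀) n₁ →
      FoldMap S θ k f F M n₁ v w M₁ n₂ → Eval S (w :: θ₀) e n₂ r n₃ →
      FoldCell S θ k f M n (.cell k a v) r ((a, r) :: M₁) n₃

/-- The action of a functor on the fold: each component of `v` at a position of `self` is folded,
from left to right, and the rest of `v` is left alone. -/
inductive FoldMap (S : List PolyFunctor) : List Val → ℕ → Tm → PolyFunctor → List (ℕ × Val) →
    ℕ → Val → Val → List (ℕ × Val) → ℕ → Prop where
  | self {θ : List Val} {k n n₁ : ℕ} {f : Tm} {M M₁ : List (ℕ × Val)} {v w : Val} :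
      FoldCell S θ k f M n v w M₁ n₁ → FoldMap S θ k f .self M n v w M₁ n₁
  | unit {θ : List Val} {k n : ℕ} {f : Tm} {M : List (ℕ × Val)} {v : Val} :
      FoldMap S θ k f .unit M n v v M n
  | data {θ : List Val} {k n j : ℕ} {f : Tm} {M : List (ℕ × Val)} {v : Val} :
      FoldMap S θ k f (.data j) M n v v M n
  | inl {θ : List Val} {k n n₁ : ℕ} {f : Tm} {F G : PolyFunctor} {M M₁ : List (ℕ × Val)}
      {v w : Val} :
      FoldMap S θ k f F M n v w M₁ n₁ →
      FoldMap S θ k f (.sum F G) M n (.inl v) (.inl w) M₁ n₁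
  | inr {θ : List Val} {k n n₁ : ℕ} {f : Tm} {F G : PolyFunctor} {M M₁ : List (ℕ × Val)}
      {v w : Val} :
      FoldMap S θ k f G M n v w M₁ n₁ →
      FoldMap S θ k f (.sum F G) M n (.inr v) (.inr w) M₁ n₁
  | pair {θ : List Val} {k n n₁ n₂ : ℕ} {f : Tm} {F G : PolyFunctor} {M M₁ M₂ : List (ℕ × Val)}
      {v₁ v₂ w₁ w₂ : Val} :
      FoldMap S θ k f F M n v₁ w₁ M₁ n₁ → FoldMap S θ k f G M₁ n₁ v₂ w₂ M₂ n₂ →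
      FoldMap S θ k f (.prod F G) M n (.pair v₁ v₂) (.pair w₁ w₂) M₂ n₂

end

/-! Environments and sizes -/

/-- `θ` is an environment for `Γ ⊢ e : τ`, and `n` is an unused address: every free variable of
`e` has a value of its type, an address always denotes the same cell, and all addresses in use
are below `n`. -/
structure IsEnv (S : List PolyFunctor) (Γ : List Ty) (e : Tm) (θ : List Val) (n : ℕ) : Prop where
  typed : ∀ x ∈ e.fv, ∃ τ v, Γ[x]? = some τ ∧ θ[x]? = some v ∧ v.HasTy S τ
  shared : ∀ x ∈ e.fv, ∀ y ∈ e.fv, ∀ v w, θ[x]? = some v → θ[y]? = some w →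
    ∀ a k₁ k₂ u₁ u₂, v.Holds k₁ a u₁ → w.Holds k₂ a u₂ → k₁ = k₂ ∧ u₁ = u₂
  fresh : ∀ x ∈ e.fv, ∀ v, θ[x]? = some v → ∀ a ∈ v.cells, a < n

/-- The apparent size of a set of variables: the number of data cons-cells in the representation
of their values, where shared cells are counted once. -/
def asize (θ : List Val) (X : Finset ℕ) : ℕ :=
  (X.biUnion fun x => ((θ[x]?).map Val.cells).getD ∅).card

/-! Polynomials and codes -/

/-- The polynomial with natural coefficients that is written as a list of monomials, each given by
its coefficient and the list of its variables (with repetitions). -/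
noncomputable def polyOf (p : List (ℕ × List ℕ)) : MvPolynomial ℕ ℕ :=
  (p.map fun c => MvPolynomial.C c.1 * (c.2.map MvPolynomial.X).prod).sum

def Mode.code : Mode → ℕ
  | .normal => 0
  | .safe => 1

def Ty.code : Ty → ℕ
  | .unit => Nat.pair 0 0
  | .data m k => Nat.pair 1 (Nat.pair m.code k)
  | .sum σ τ => Nat.pair 2 (Nat.pair σ.code τ.code)
  | .prod σ τ => Nat.pair 3 (Nat.pair σ.code τ.code)
  | .arrow σ τ => Nat.pair 4 (Nat.pair σ.code τ.code)

def PolyFunctor.code : PolyFunctor → ℕ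
  | .self => Nat.pair 0 0
  | .unit => Nat.pair 1 0
  | .data j => Nat.pair 2 j
  | .sum F G => Nat.pair 3 (Nat.pair F.code G.code)
  | .prod F G => Nat.pair 4 (Nat.pair F.code G.code)

def Tm.code : Tm → ℕ
  | .var i => Nat.pair 0 i
  | .lam e => Nat.pair 1 e.code
  | .app e₁ e₂ => Nat.pair 2 (Nat.pair e₁.code e₂.code)
  | .unit => Nat.pair 3 0
  | .pair e₁ e₂ => Nat.pair 4 (Nat.pair e₁.code e₂.code)
  | .fst e => Nat.pair 5 e.code
  | .snd e => Nat.pair 6 e.code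
  | .inl e => Nat.pair 7 e.code
  | .inr e => Nat.pair 8 e.code
  | .case e e₁ e₂ => Nat.pair 9 (Nat.pair e.code (Nat.pair e₁.code e₂.code))
  | .con m k e => Nat.pair 10 (Nat.pair m.code (Nat.pair k e.code))
  | .des m k e => Nat.pair 11 (Nat.pair m.code (Nat.pair k e.code))
  | .fold k f e => Nat.pair 12 (Nat.pair k (Nat.pair f.code e.code))

/-- The code of the declarations `S` together with the judgment `Γ ⊢ e : τ`. -/
def judgmentCode (S : List PolyFunctor) (Γ : List Ty) (e : Tm) (τ : Ty) :
    List ℕ × List ℕ × ℕ × ℕ :=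
  (S.map PolyFunctor.code, Γ.map Ty.code, e.code, τ.code)

end RS

namespace RS

open Nat.Partrec (Code)
open Encodable (encode decode)

/-! Typed partial recursive codes and recursion by the second recursion theorem -/

section Run

variable {α β γ : Type*} [Primcodable α] [Primcodable β] [Primcodable γ]

/-- Run a code on an encoded argument and decode the result. -/
def run (c : Code) (a : α) : Part β :=
  (c.eval (encode a)).bind fun n => ((decode n : Option β) : Part β)

theorem partrec_run {c : γ → Code} {a : γ → α} (hc : Computable c) (ha : Computable a) :
    Partrec fun x => (run (c x) (a x) : Part β) :=
  (Code.eval_part.comp hc (Computable.encode.comp ha)).bind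
    (Computable.ofOption (Computable.decode.comp Computable.snd)).to₂

theorem exists_run_eq {f : Code → α →. β} (hf : Partrec₂ f) :
    ∃ c : Code, ∀ a, run c a = f c a := by
  have h : Partrec₂ fun (c : Code) (n : ℕ) =>
      ((decode n : Option α) : Part α).bind fun a => (f c a).map encode := by
    refine Partrec.bind (Computable.ofOption (Computable.decode.comp Computable.snd)) ?_
    refine Partrec.map ?_ (Computable.encode.comp Computable.snd).to₂
    exact hf.comp (Computable.fst.comp Computable.fst) Computable.snd
  obtain ⟨c, hc⟩ := Code.fixed_point₂ h
  refine ⟨c, fun a => ?_⟩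
  simp [run, hc, Part.bind_map, Part.bind_some_right]

theorem run_curry (c : Code) (a : α) (b : β) :
    (run (c.curry (encode a)) b : Part γ) = run c (a, b) := by
  simp [run, Code.eval_curry]

theorem exists_run_comp {f : α → β} (hf : Computable f) :
    ∃ c' : Code, ∀ (c : Code) (a : α), (run (c.comp c') a : Part γ) = run c (f a) := by
  obtain ⟨c', hc'⟩ := Code.exists_code.1 hf
  refine ⟨c', fun c a => ?_⟩
  have h : (c.comp c').eval (encode a) = c.eval (encode (f a)) := by
    change (c'.eval (encode a)).bind c.eval = _
    simp only [hc', Encodable.encodek, Part.coe_some, Part.bind_some, PFun.coe_val, Part.map_some]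
    exact Part.bind_some _ _
  simp only [run, h]

end Run

/-! The interpreter of terms by size bounds -/

/-- Polynomials as lists of monomials. -/
abbrev PolyList := List (ℕ × List ℕ)

/-- Product of polynomials. -/
def PolyList.mul (p q : PolyList) : PolyList :=
  p.flatMap fun c => q.map fun d => (c.1 * d.1, c.2 ++ d.2)

/-- The bound of a value: a polynomial for values of ground type, and a code that maps bounds
to bounds for functions. -/
abbrev Bound := PolyList × Code

/-- The bound of a ground value. -/
def Bound.ground (p : PolyList) : Bound := (p, Code.zero)

/-- Application of the bound of a function. -/
def Bound.app (d a : Bound) : Part Bound := run d.2 a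

theorem exists_joinCode : ∃ j : Code, ∀ x : (Code × Code) × Bound, (run j x : Part Bound) =
    (run x.1.1 x.2 : Part Bound).bind fun d₁ => (run x.1.2 x.2 : Part Bound).bind fun d₂ =>
      Part.some (d₁.1 ++ d₂.1, j.curry (encode (d₁.2, d₂.2))) := by
  refine exists_run_eq (f := fun (j : Code) (x : (Code × Code) × Bound) =>
    (run x.1.1 x.2 : Part Bound).bind fun d₁ => (run x.1.2 x.2 : Part Bound).bind fun d₂ =>
      Part.some (d₁.1 ++ d₂.1, j.curry (encode (d₁.2, d₂.2)))) ?_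
  refine Partrec.bind (partrec_run ?_ ?_) (Partrec.bind (partrec_run ?_ ?_) (Computable.partrec ?_))
  · exact Computable.fst.comp (Computable.fst.comp Computable.snd)
  · exact Computable.snd.comp Computable.snd
  · exact Computable.snd.comp (Computable.fst.comp (Computable.snd.comp Computable.fst))
  · exact Computable.snd.comp (Computable.snd.comp Computable.fst)
  · refine Computable.pair (Computable.list_append.comp ?_ ?_)
      (Code.primrec₂_curry.to_comp.comp ?_ (Computable.encode.comp (Computable.pair ?_ ?_)))
    · exact Computable.fst.comp (Computable.snd.comp Computable.fst)
    · exact Computable.fst.comp Computable.snd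
    · exact Computable.fst.comp (Computable.fst.comp Computable.fst)
    · exact Computable.snd.comp (Computable.snd.comp Computable.fst)
    · exact Computable.snd.comp Computable.snd

/-- The code of the pointwise join of two functions. -/
noncomputable def joinCode : Code := exists_joinCode.choose

/-- The join of two bounds of the same type. -/
noncomputable def Bound.join (d₁ d₂ : Bound) : Bound :=
  (d₁.1 ++ d₂.1, joinCode.curry (encode (d₁.2, d₂.2)))

theorem Bound.join_app (d₁ d₂ a : Bound) : (d₁.join d₂).app a =
    (d₁.app a).bind fun b₁ => (d₂.app a).bind fun b₂ => Part.some (b₁.join b₂) := by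
  simp only [Bound.app, Bound.join, run_curry]
  exact exists_joinCode.choose_spec _

theorem computable_join {α : Type*} [Primcodable α] {f g : α → Bound} (hf : Computable f)
    (hg : Computable g) : Computable fun x => (f x).join (g x) :=
  Computable.pair (Computable.list_append.comp (Computable.fst.comp hf) (Computable.fst.comp hg))
    (Code.primrec₂_curry.to_comp.comp (Computable.const _) (Computable.encode.comp
      (Computable.pair (Computable.snd.comp hf) (Computable.snd.comp hg))))

theorem primrec_mul : Primrec₂ PolyList.mul := by
  refine Primrec.list_flatMap Primrec.fst (Primrec.list_map (Primrec.snd.comp Primrec.fst) ?_)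
  refine Primrec.pair (Primrec.nat_mul.comp ?_ ?_) (Primrec.list_append.comp ?_ ?_)
  · exact Primrec.fst.comp (Primrec.snd.comp Primrec.fst)
  · exact Primrec.fst.comp Primrec.snd
  · exact Primrec.snd.comp (Primrec.snd.comp Primrec.fst)
  · exact Primrec.snd.comp Primrec.snd

/-- The argument of the interpreter for the body of a function. -/
def pushArg (x : (ℕ × List Bound) × Bound) : ℕ × List Bound := (x.1.1, x.2 :: x.1.2)

theorem exists_pushCode : ∃ c' : Code, ∀ (c : Code) (x : (ℕ × List Bound) × Bound),
    (run (c.comp c') x : Part Bound) = run c (pushArg x) :=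
  exists_run_comp (Computable.pair (Computable.fst.comp Computable.fst)
    (Computable.list_cons.comp Computable.snd (Computable.snd.comp Computable.fst)))

/-- A code for `pushArg`. -/
noncomputable def pushCode : Code := exists_pushCode.choose

/-- The code of the function with the given body and environment, where `c` is a code of the
interpreter. -/
noncomputable def closureCode (c : Code) (e : ℕ) (ρ : List Bound) : Code :=
  (c.comp pushCode).curry (encode (e, ρ))

theorem run_closureCode (c : Code) (e : ℕ) (ρ : List Bound) (a : Bound) :
    (run (closureCode c e ρ) a : Part Bound) = run c (e, a :: ρ) := by
  rw [closureCode, run_curry]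
  exact exists_pushCode.choose_spec _ _

theorem computable_closureCode {α : Type*} [Primcodable α] {c : α → Code} {e : α → ℕ}
    {ρ : α → List Bound} (hc : Computable c) (he : Computable e) (hρ : Computable ρ) :
    Computable fun x => closureCode (c x) (e x) (ρ x) :=
  Code.primrec₂_curry.to_comp.comp (Code.primrec₂_comp.to_comp.comp hc (Computable.const _))
    (Computable.encode.comp (Computable.pair he hρ))

/-- The interpreter on a term with tag `t` and contents `b`, where `ev` is the interpreter for
subterms and `c` is a code of it. -/
noncomputable def interpretStep (c : Code) (x : ℕ × List Bound) : Part Bound :=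
  let ev (e : ℕ) (ρ : List Bound) : Part Bound := run c (e, ρ)
  let t := x.1.unpair.1
  let b := x.1.unpair.2
  let ρ := x.2
  bif t == 0 then (ρ[b]? : Option Bound)
  else bif t == 1 then Part.some ([], closureCode c b ρ)
  else bif t == 2 then
    (ev b.unpair.1 ρ).bind fun d₁ => (ev b.unpair.2 ρ).bind fun d₂ => run d₁.2 d₂
  else bif t == 3 then Part.some (Bound.ground [])
  else bif t == 4 then
    (ev b.unpair.1 ρ).bind fun d₁ => (ev b.unpair.2 ρ).bind fun d₂ =>
      Part.some (Bound.ground (d₁.1 ++ d₂.1))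
  else bif t == 9 then
    (ev b.unpair.1 ρ).bind fun d => (ev b.unpair.2.unpair.1 (d :: ρ)).bind fun d₁ =>
      (ev b.unpair.2.unpair.2 (d :: ρ)).bind fun d₂ => Part.some (d₁.join d₂)
  else bif t == 10 then
    (ev b.unpair.2.unpair.2 ρ).bind fun d => Part.some (Bound.ground ((1, []) :: d.1))
  else bif t == 11 then ev b.unpair.2.unpair.2 ρ
  else bif t == 12 then
    (ev b.unpair.2.unpair.1 ρ).bind fun d₁ => (ev b.unpair.2.unpair.2 ρ).bind fun d₂ =>
      (run d₁.2 (Bound.ground d₂.1) : Part Bound).bind fun d₃ =>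
        Part.some (Bound.ground (d₂.1.mul d₃.1))
  else ev b ρ

theorem partrec_interpretStep : Partrec₂ interpretStep := by
  have hc : Computable fun y : Code × (ℕ × List Bound) => y.1 := Computable.fst
  have hρ : Computable fun y : Code × (ℕ × List Bound) => y.2.2 :=
    Computable.snd.comp Computable.snd
  have hu : Computable fun y : Code × (ℕ × List Bound) => y.2.1.unpair :=
    Computable.unpair.comp (Computable.fst.comp Computable.snd)
  have ht := Computable.fst.comp hu
  have hb := Computable.snd.comp hu
  have hb₁ := Computable.fst.comp (Computable.unpair.comp hb)
  have hb₂ := Computable.snd.comp (Computable.unpair.comp hb)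
  have hb₂₁ := Computable.fst.comp (Computable.unpair.comp hb₂)
  have hb₂₂ := Computable.snd.comp (Computable.unpair.comp hb₂)
  have htag (k : ℕ) : Computable fun y : Code × (ℕ × List Bound) => y.2.1.unpair.1 == k :=
    (Primrec.beq (α := ℕ)).to_comp.comp ht (Computable.const k)
  have hground {α : Type} [Primcodable α] {f : α → PolyList} (hf : Computable f) :
      Computable fun x => Bound.ground (f x) := Computable.pair hf (Computable.const _)
  have hev {e : Code × (ℕ × List Bound) → ℕ} (he : Computable e) :
      Partrec fun y : Code × (ℕ × List Bound) => (run y.1 (e y, y.2.2) : Part Bound) :=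
    partrec_run hc (Computable.pair he hρ)
  refine (Partrec.cond (htag 0) ?_ <| Partrec.cond (htag 1) ?_ <| Partrec.cond (htag 2) ?_ <|
    Partrec.cond (htag 3) ?_ <| Partrec.cond (htag 4) ?_ <| Partrec.cond (htag 9) ?_ <|
    Partrec.cond (htag 10) ?_ <| Partrec.cond (htag 11) ?_ <| Partrec.cond (htag 12) ?_ ?_ :
    Partrec fun y : Code × (ℕ × List Bound) => interpretStep y.1 y.2)
  · exact Computable.ofOption (Computable.list_getElem?.comp hρ hb)
  · exact Computable.partrec (Computable.pair (Computable.const _) (computable_closureCode hc hb hρ))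
  · refine (hev hb₁).bind (Partrec.bind ((hev hb₂).comp Computable.fst) (partrec_run ?_ ?_))
    · exact Computable.snd.comp (Computable.snd.comp Computable.fst)
    · exact Computable.snd
  · exact Computable.partrec (Computable.const _)
  · refine (hev hb₁).bind (Partrec.bind ((hev hb₂).comp Computable.fst)
      (Computable.partrec (hground (Computable.list_append.comp ?_ ?_))))
    · exact Computable.fst.comp (Computable.snd.comp Computable.fst)
    · exact Computable.fst.comp Computable.snd
  · refine (hev hb₁).bind (Partrec.bind (partrec_run (hc.comp Computable.fst)
      (Computable.pair (hb₂₁.comp Computable.fst)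
        (Computable.list_cons.comp Computable.snd (hρ.comp Computable.fst))))
      (Partrec.bind (partrec_run (hc.comp (Computable.fst.comp Computable.fst))
      (Computable.pair (hb₂₂.comp (Computable.fst.comp Computable.fst))
        (Computable.list_cons.comp (Computable.snd.comp Computable.fst)
          (hρ.comp (Computable.fst.comp Computable.fst)))))
      (Computable.partrec (computable_join (Computable.snd.comp Computable.fst) Computable.snd))))
  · exact (hev hb₂₂).bind (Computable.partrec (hground
      (Computable.list_cons.comp (Computable.const _) (Computable.fst.comp Computable.snd))))
  · exact hev hb₂₂
  · refine (hev hb₂₁).bind (Partrec.bind ((hev hb₂₂).comp Computable.fst)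
      (Partrec.bind (partrec_run ?_ (hground ?_))
        (Computable.partrec (hground (primrec_mul.to_comp.comp ?_ ?_)))))
    · exact Computable.snd.comp (Computable.snd.comp Computable.fst)
    · exact Computable.fst.comp Computable.snd
    · exact Computable.fst.comp (Computable.snd.comp Computable.fst)
    · exact Computable.fst.comp Computable.snd
  · exact hev hb

theorem exists_interpretCode : ∃ c : Code, ∀ x, run c x = interpretStep c x :=
  exists_run_eq partrec_interpretStep

/-- A code of the interpreter. -/
noncomputable def interpretCode : Code := exists_interpretCode.choose

/-- The bound of the value of `e`, given bounds for the values of the variables. -/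
noncomputable def Tm.bound (e : Tm) (ρ : List Bound) : Part Bound := run interpretCode (e.code, ρ)

theorem Tm.bound_eq (e : Tm) (ρ : List Bound) :
    e.bound ρ = interpretStep interpretCode (e.code, ρ) :=
  exists_interpretCode.choose_spec _

section Equations

variable (ρ : List Bound) (e e₁ e₂ : Tm) (m : Mode) (k : ℕ)

/-- The bound of the function `lam e`. -/
noncomputable def Tm.lamBound : Bound := ([], closureCode interpretCode e.code ρ)

theorem Tm.lamBound_app (a : Bound) : (Tm.lamBound ρ e).app a = e.bound (a :: ρ) :=
  run_closureCode _ _ _ _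

theorem Tm.bound_var : (Tm.var k).bound ρ = (ρ[k]? : Option Bound) := by
  simp [Tm.bound_eq, interpretStep, Tm.code]

theorem Tm.bound_lam : (Tm.lam e).bound ρ = Part.some (Tm.lamBound ρ e) := by
  simp [Tm.bound_eq, interpretStep, Tm.code, Tm.lamBound]

theorem Tm.bound_app : (Tm.app e₁ e₂).bound ρ =
    (e₁.bound ρ).bind fun d₁ => (e₂.bound ρ).bind fun d₂ => d₁.app d₂ := by
  rw [Tm.bound_eq]; simp [interpretStep, Tm.code, Tm.bound, Bound.app]

theorem Tm.bound_unit : Tm.unit.bound ρ = Part.some (Bound.ground []) := by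
  rw [Tm.bound_eq]; simp [interpretStep, Tm.code]

theorem Tm.bound_pair : (Tm.pair e₁ e₂).bound ρ = (e₁.bound ρ).bind fun d₁ =>
    (e₂.bound ρ).bind fun d₂ => Part.some (Bound.ground (d₁.1 ++ d₂.1)) := by
  rw [Tm.bound_eq]; simp [interpretStep, Tm.code, Tm.bound]

theorem Tm.bound_fst : (Tm.fst e).bound ρ = e.bound ρ := by
  rw [Tm.bound_eq]; simp [interpretStep, Tm.code, Tm.bound]

theorem Tm.bound_snd : (Tm.snd e).bound ρ = e.bound ρ := by
  rw [Tm.bound_eq]; simp [interpretStep, Tm.code, Tm.bound]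

theorem Tm.bound_inl : (Tm.inl e).bound ρ = e.bound ρ := by
  rw [Tm.bound_eq]; simp [interpretStep, Tm.code, Tm.bound]

theorem Tm.bound_inr : (Tm.inr e).bound ρ = e.bound ρ := by
  rw [Tm.bound_eq]; simp [interpretStep, Tm.code, Tm.bound]

theorem Tm.bound_case : (Tm.case e e₁ e₂).bound ρ = (e.bound ρ).bind fun d =>
    (e₁.bound (d :: ρ)).bind fun d₁ => (e₂.bound (d :: ρ)).bind fun d₂ =>
      Part.some (d₁.join d₂) := by
  rw [Tm.bound_eq]; simp [interpretStep, Tm.code, Tm.bound]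

theorem Tm.bound_con : (Tm.con m k e).bound ρ =
    (e.bound ρ).bind fun d => Part.some (Bound.ground ((1, []) :: d.1)) := by
  rw [Tm.bound_eq]; simp [interpretStep, Tm.code, Tm.bound]

theorem Tm.bound_des : (Tm.des m k e).bound ρ = e.bound ρ := by
  rw [Tm.bound_eq]; simp [interpretStep, Tm.code, Tm.bound]

theorem Tm.bound_fold : (Tm.fold k e₁ e₂).bound ρ = (e₁.bound ρ).bind fun d₁ =>
    (e₂.bound ρ).bind fun d₂ => (d₁.app (Bound.ground d₂.1)).bind fun d₃ =>
      Part.some (Bound.ground (d₂.1.mul d₃.1)) := by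
  rw [Tm.bound_eq]; simp [interpretStep, Tm.code, Tm.bound, Bound.app]

end Equations

/-! The bounds of the variables -/

/-- One step of the recognition of codes of normal ground types. -/
def normalStep (c : Code) (t : ℕ) : Part Bool :=
  bif t.unpair.1 == 0 then Part.some true
  else bif t.unpair.1 == 1 then Part.some (t.unpair.2.unpair.1 == 0)
  else bif t.unpair.1 == 4 then Part.some false
  else (run c t.unpair.2.unpair.1 : Part Bool).bind fun b₁ =>
    (run c t.unpair.2.unpair.2 : Part Bool).bind fun b₂ => Part.some (b₁ && b₂)

theorem partrec_normalStep : Partrec₂ normalStep := by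
  have hu : Computable fun y : Code × ℕ => y.2.unpair := Computable.unpair.comp Computable.snd
  have ht := Computable.fst.comp hu
  have hu₂ := Computable.unpair.comp (Computable.snd.comp hu)
  have htag (k : ℕ) : Computable fun y : Code × ℕ => y.2.unpair.1 == k :=
    (Primrec.beq (α := ℕ)).to_comp.comp ht (Computable.const k)
  refine (Partrec.cond (htag 0) (Computable.partrec (Computable.const _)) <|
    Partrec.cond (htag 1) (Computable.partrec ((Primrec.beq (α := ℕ)).to_comp.comp
      (Computable.fst.comp hu₂) (Computable.const 0))) <|
    Partrec.cond (htag 4) (Computable.partrec (Computable.const _)) <|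
    Partrec.bind (partrec_run Computable.fst (Computable.fst.comp hu₂)) <|
    Partrec.bind (partrec_run (Computable.fst.comp Computable.fst)
      ((Computable.snd.comp hu₂).comp Computable.fst)) <|
    Computable.partrec (Primrec.and.to_comp.comp (Computable.snd.comp Computable.fst)
      Computable.snd) :
    Partrec fun y : Code × ℕ => normalStep y.1 y.2)

theorem exists_normalCode : ∃ c : Code, ∀ σ : Ty, run c σ.code = Part.some σ.isNormal := by
  obtain ⟨c, hc⟩ := exists_run_eq partrec_normalStep
  refine ⟨c, fun σ => ?_⟩
  induction σ with
  | unit => rw [hc]; simp [ normalStep, Ty.code, Ty.isNormal]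
  | data m k => rw [hc]; cases m <;> simp [ normalStep, Ty.code, Mode.code, Ty.isNormal]
  | sum σ τ hσ hτ => rw [hc]; simp [normalStep, Ty.code, Ty.isNormal, hσ, hτ]
  | prod σ τ hσ hτ => rw [hc]; simp [normalStep, Ty.code, Ty.isNormal, hσ, hτ]
  | arrow σ τ => rw [hc]; simp [ normalStep, Ty.code, Ty.isNormal]

/-- A code of the recognition of normal ground types. -/
noncomputable def normalCode : Code := exists_normalCode.choose

/-- The bound of the variable `i`: its own size if its type is normal, and zero otherwise. -/
def varBound (i : ℕ) (b : Bool) : Bound := Bound.ground (bif b then [(1, [i])] else [])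

/-- One step of the computation of the bounds of variables from the codes of their types, where
`i` is the index of the first variable. -/
noncomputable def varsStep (c : Code) (x : List ℕ × ℕ) : Part (List Bound) :=
  bif x.1.length == 0 then Part.some []
  else (run normalCode x.1.headI : Part Bool).bind fun b =>
    (run c (x.1.tail, x.2 + 1) : Part (List Bound)).bind fun ρ => Part.some (varBound x.2 b :: ρ)

theorem partrec_varsStep : Partrec₂ varsStep := by
  have hΓ : Computable fun y : Code × (List ℕ × ℕ) => y.2.1 :=
    Computable.fst.comp Computable.snd
  have hi : Computable fun y : Code × (List ℕ × ℕ) => y.2.2 :=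
    Computable.snd.comp Computable.snd
  have hvar : Computable₂ varBound :=
    Computable.pair (Computable.cond Computable.snd (Computable.list_cons.comp
      (Computable.pair (Computable.const 1) (Computable.list_cons.comp Computable.fst
        (Computable.const []))) (Computable.const [])) (Computable.const [])) (Computable.const _)
  refine (Partrec.cond ((Primrec.beq (α := ℕ)).to_comp.comp (Computable.list_length.comp hΓ)
    (Computable.const 0)) (Computable.partrec (Computable.const _)) <|
    Partrec.bind (partrec_run (Computable.const normalCode)
      (Primrec.list_headI.to_comp.comp hΓ)) <|
    Partrec.bind (partrec_run (Computable.fst.comp Computable.fst) (Computable.pair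
      ((Primrec.list_tail.to_comp.comp hΓ).comp Computable.fst)
      ((Computable.succ.comp hi).comp Computable.fst))) <|
    Computable.partrec (Computable.list_cons.comp (hvar.comp
      (hi.comp (Computable.fst.comp Computable.fst)) (Computable.snd.comp Computable.fst))
      Computable.snd) : Partrec fun y : Code × (List ℕ × ℕ) => varsStep y.1 y.2)

/-- The bounds of the variables of a context, the first of which has index `i`. -/
def varBounds : ℕ → List Ty → List Bound
  | _, [] => []
  | i, σ :: Γ => varBound i σ.isNormal :: varBounds (i + 1) Γ

theorem getElem?_varBounds (i : ℕ) (Γ : List Ty) (x : ℕ) :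
    (varBounds i Γ)[x]? = Γ[x]?.map fun σ => varBound (i + x) σ.isNormal := by
  induction Γ generalizing i x with
  | nil => rfl
  | cons σ Γ ih =>
    cases x with
    | zero => rfl
    | succ x => simp [varBounds, ih, Nat.add_right_comm, Nat.add_assoc]

theorem exists_varsCode : ∃ c : Code, ∀ (Γ : List Ty) (i : ℕ), run c (Γ.map Ty.code, i) =
    Part.some (varBounds i Γ) := by
  obtain ⟨c, hc⟩ := exists_run_eq partrec_varsStep
  refine ⟨c, fun Γ => ?_⟩
  induction Γ with
  | nil => intro i; rw [hc]; simp [varsStep, varBounds]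
  | cons σ Γ ih =>
    intro i
    rw [hc]
    simp [varsStep, varBounds, ih, normalCode, exists_normalCode.choose_spec]

/-- The polynomial bounding the size of the value of a term in terms of the sizes of its
variables, computed from the code of a judgment. -/
noncomputable def judgmentBound (x : List ℕ × List ℕ × ℕ × ℕ) : Part PolyList :=
  (run exists_varsCode.choose (x.2.1, 0) : Part (List Bound)).bind fun ρ =>
    (run interpretCode (x.2.2.1, ρ) : Part Bound).map Prod.fst

theorem partrec_judgmentBound : Partrec judgmentBound := by
  refine Partrec.bind (partrec_run (Computable.const _) (Computable.pair
    (Computable.fst.comp Computable.snd) (Computable.const 0))) (Partrec.map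
    (partrec_run (Computable.const _) (Computable.pair (Computable.fst.comp
      (Computable.snd.comp (Computable.snd.comp Computable.fst))) Computable.snd))
      (Computable.fst.comp Computable.snd).to₂)

theorem judgmentBound_judgmentCode (S : List PolyFunctor) (Γ : List Ty) (e : Tm) (τ : Ty) :
    judgmentBound (judgmentCode S Γ e τ) = (e.bound (varBounds 0 Γ)).map Prod.fst := by
  simp [judgmentBound, judgmentCode, exists_varsCode.choose_spec, Tm.bound]

/-! Polynomials -/

theorem polyOf_nil : polyOf [] = 0 := rfl

theorem polyOf_append (p q : PolyList) : polyOf (p ++ q) = polyOf p + polyOf q := by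
  simp [polyOf]

theorem polyOf_cons_one (p : PolyList) : polyOf ((1, []) :: p) = 1 + polyOf p := by
  simp [polyOf]

theorem polyOf_mul (p q : PolyList) : polyOf (p.mul q) = polyOf p * polyOf q := by
  induction p with
  | nil => simp [PolyList.mul, polyOf_nil]
  | cons c p ih =>
    have h : PolyList.mul (c :: p) q =
        q.map (fun d => (c.1 * d.1, c.2 ++ d.2)) ++ PolyList.mul p q := by
      simp [PolyList.mul]
    have h' : polyOf (c :: p) = MvPolynomial.C c.1 * (c.2.map MvPolynomial.X).prod + polyOf p := by
      simp [polyOf]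
    rw [h, polyOf_append, ih, h', add_mul]
    congr 1
    simp only [polyOf, List.map_map]
    rw [← List.sum_map_mul_left]
    congr 1
    refine List.map_congr_left fun d _ => ?_
    simp only [Function.comp, List.map_append, List.prod_append, map_mul]
    ring

theorem vars_polyOf_mul (p q : PolyList) :
    (polyOf (p.mul q)).vars ⊆ (polyOf p).vars ∪ (polyOf q).vars := by
  rw [polyOf_mul]
  exact MvPolynomial.vars_mul _ _

theorem vars_polyOf_append (p q : PolyList) :
    (polyOf (p ++ q)).vars ⊆ (polyOf p).vars ∪ (polyOf q).vars := by
  rw [polyOf_append]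
  exact MvPolynomial.vars_add_subset _ _

theorem vars_polyOf_cons_one (p : PolyList) : (polyOf ((1, []) :: p)).vars ⊆ (polyOf p).vars := by
  rw [polyOf_cons_one]
  refine (MvPolynomial.vars_add_subset _ _).trans ?_
  simp

/-! Types -/

theorem Ty.isGround_of_isNormal {σ : Ty} (h : σ.isNormal) : σ.isGround := by
  induction σ with
  | unit | data => rfl
  | sum σ τ hσ hτ | prod σ τ hσ hτ => simp_all [Ty.isNormal, Ty.isGround]
  | arrow => simp [Ty.isNormal] at h

theorem Ty.isGround_of_isSafe {σ : Ty} (h : σ.isSafe) : σ.isGround := by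
  induction σ with
  | unit | data => rfl
  | sum σ τ hσ hτ | prod σ τ hσ hτ => simp_all [Ty.isSafe, Ty.isGround]
  | arrow => simp [Ty.isSafe] at h

theorem SameSort.isGround {σ τ : Ty} (h : SameSort σ τ) : σ.isGround ∧ τ.isGround := by
  rcases h with ⟨h₁, h₂⟩ | ⟨h₁, h₂⟩
  · exact ⟨Ty.isGround_of_isNormal h₁, Ty.isGround_of_isNormal h₂⟩
  · exact ⟨Ty.isGround_of_isSafe h₁, Ty.isGround_of_isSafe h₂⟩

theorem Ty.isGround_toSafe {σ : Ty} (h : σ.isGround) : σ.toSafe.isGround := by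
  induction σ with
  | unit | data => rfl
  | sum σ τ hσ hτ | prod σ τ hσ hτ => simp_all [Ty.toSafe, Ty.isGround]
  | arrow => simp [Ty.isGround] at h

theorem Ty.isSafe_toSafe {σ : Ty} (h : σ.isNormal) : σ.toSafe.isSafe := by
  induction σ with
  | unit | data => rfl
  | sum σ τ hσ hτ | prod σ τ hσ hτ => simp_all [Ty.toSafe, Ty.isSafe, Ty.isNormal]
  | arrow => simp [Ty.isNormal] at h

theorem Ty.toSafe_toSafe (σ : Ty) : σ.toSafe.toSafe = σ.toSafe := by
  induction σ <;> simp_all [Ty.toSafe]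

theorem Ty.isNormal_of_isSafe {σ : Ty} (h : σ.isSafe) (h' : σ.deliversSafe = false) :
    σ.isNormal := by
  induction σ with
  | unit => rfl
  | data m => cases m <;> simp_all [Ty.deliversSafe, Ty.isSafe]
  | sum σ τ hσ hτ | prod σ τ hσ hτ => simp_all [Ty.isSafe, Ty.isNormal, Ty.deliversSafe]
  | arrow => simp [Ty.isSafe] at h

namespace PolyFunctor

theorem isGround_inst (F : PolyFunctor) (m : Mode) {σ : Ty} (h : σ.isGround) :
    (F.inst m σ).isGround := by
  induction F <;> simp_all [inst, Ty.isGround]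

theorem isNormal_inst (F : PolyFunctor) {σ : Ty} (h : σ.isNormal) :
    (F.inst .normal σ).isNormal := by
  induction F <;> simp_all [inst, Ty.isNormal]

theorem isSafe_inst (F : PolyFunctor) {σ : Ty} (h : σ.isSafe) :
    (F.inst .safe σ).isSafe := by
  induction F <;> simp_all [inst, Ty.isSafe]

theorem toSafe_inst (F : PolyFunctor) (m : Mode) (σ : Ty) :
    (F.inst m σ).toSafe = F.inst .safe σ.toSafe := by
  induction F <;> simp_all [inst, Ty.toSafe]

end PolyFunctor

theorem succ_mem_iff_mem_unbind {s : Finset ℕ} {x : ℕ} : x ∈ unbind s ↔ x + 1 ∈ s := by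
  simp only [unbind, Finset.mem_image, Finset.mem_erase]
  constructor
  · rintro ⟨y, ⟨hy, hs⟩, rfl⟩
    rwa [Nat.pred_eq_sub_one, Nat.sub_add_cancel (Nat.pos_of_ne_zero hy)]
  · exact fun h => ⟨x + 1, ⟨by simp, h⟩, rfl⟩

/-! Termination of the interpreter -/

/-- The bounds of a type: polynomials in the variables `V` at ground types, and codes that
preserve boundedness at function types. -/
def Reducible (V : Finset ℕ) : Ty → Bound → Prop
  | .unit, d => (polyOf d.1).vars ⊆ V
  | .data _ _, d => (polyOf d.1).vars ⊆ V
  | .sum σ τ, d => (Ty.sum σ τ).isGround ∧ (polyOf d.1).vars ⊆ V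
  | .prod σ τ, d => (Ty.prod σ τ).isGround ∧ (polyOf d.1).vars ⊆ V
  | .arrow σ τ, d => ∀ a, Reducible V σ a → ∃ b ∈ d.app a, Reducible V τ b

theorem reducible_iff_of_isGround {V : Finset ℕ} {σ : Ty} (h : σ.isGround) {d : Bound} :
    Reducible V σ d ↔ (polyOf d.1).vars ⊆ V := by
  cases σ with
  | unit | data => rfl
  | sum | prod => simp [Reducible, h]
  | arrow => simp [Ty.isGround] at h

theorem Reducible.join {V : Finset ℕ} {σ : Ty} {d₁ d₂ : Bound} (h₁ : Reducible V σ d₁)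
    (h₂ : Reducible V σ d₂) : Reducible V σ (d₁.join d₂) := by
  induction σ generalizing d₁ d₂ with
  | unit | data => exact (vars_polyOf_append _ _).trans (Finset.union_subset h₁ h₂)
  | sum | prod =>
    exact ⟨h₁.1, (vars_polyOf_append _ _).trans (Finset.union_subset h₁.2 h₂.2)⟩
  | arrow σ τ _ ih =>
    intro a ha
    obtain ⟨b₁, hb₁, hr₁⟩ := h₁ a ha
    obtain ⟨b₂, hb₂, hr₂⟩ := h₂ a ha
    refine ⟨b₁.join b₂, ?_, ih hr₁ hr₂⟩
    rw [Bound.join_app]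
    exact Part.mem_bind hb₁ (Part.mem_bind hb₂ (Part.mem_some _))

/-- The variables in `s` have bounds of their types. -/
def ReducibleEnv (V : Finset ℕ) (Γ : List Ty) (s : Finset ℕ) (ρ : List Bound) : Prop :=
  ∀ x ∈ s, ∃ σ d, Γ[x]? = some σ ∧ ρ[x]? = some d ∧ Reducible V σ d

theorem ReducibleEnv.mono {V : Finset ℕ} {Γ : List Ty} {s t : Finset ℕ} {ρ : List Bound}
    (h : ReducibleEnv V Γ t ρ) (hst : s ⊆ t) : ReducibleEnv V Γ s ρ :=
  fun x hx => h x (hst hx)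

theorem ReducibleEnv.cons {V : Finset ℕ} {Γ : List Ty} {s : Finset ℕ} {ρ : List Bound} {σ : Ty}
    {a : Bound} (h : ReducibleEnv V Γ (unbind s) ρ) (ha : Reducible V σ a) :
    ReducibleEnv V (σ :: Γ) s (a :: ρ) := by
  intro x hx
  cases x with
  | zero => exact ⟨σ, a, rfl, rfl, ha⟩
  | succ x => exact h x (succ_mem_iff_mem_unbind.2 hx)

theorem HasType.exists_bound {S : List PolyFunctor} {V : Finset ℕ} {Γ : List Ty} {e : Tm} {τ : Ty}
    (h : HasType S Γ e τ) {ρ : List Bound} (hρ : ReducibleEnv V Γ e.fv ρ) :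
    ∃ d ∈ e.bound ρ, Reducible V τ d := by
  induction h generalizing ρ with
  | @var Γ i τ hi =>
    obtain ⟨σ, d, hσ, hd, hr⟩ := hρ i (by simp [Tm.fv])
    obtain rfl : τ = σ := by rw [hi] at hσ; exact Option.some.inj hσ
    exact ⟨d, by simp [Tm.bound_var, hd], hr⟩
  | lam h ih =>
    refine ⟨_, by rw [Tm.bound_lam]; exact Part.mem_some _, fun a ha => ?_⟩
    rw [Tm.lamBound_app]
    exact ih (hρ.cons ha)
  | app h₁ h₂ ih₁ ih₂ =>
    obtain ⟨d₁, hd₁, hr₁⟩ := ih₁ (hρ.mono Finset.subset_union_left)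
    obtain ⟨d₂, hd₂, hr₂⟩ := ih₂ (hρ.mono Finset.subset_union_right)
    obtain ⟨b, hb, hr⟩ := hr₁ d₂ hr₂
    refine ⟨b, ?_, hr⟩
    rw [Tm.bound_app]
    exact Part.mem_bind hd₁ (Part.mem_bind hd₂ hb)
  | unit =>
    refine ⟨_, by rw [Tm.bound_unit]; exact Part.mem_some _, ?_⟩
    simp [Reducible, Bound.ground, polyOf_nil]
  | pair h₁ h₂ hs ih₁ ih₂ =>
    obtain ⟨d₁, hd₁, hr₁⟩ := ih₁ (hρ.mono Finset.subset_union_left)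
    obtain ⟨d₂, hd₂, hr₂⟩ := ih₂ (hρ.mono Finset.subset_union_right)
    obtain ⟨g₁, g₂⟩ := hs.isGround
    rw [reducible_iff_of_isGround g₁] at hr₁
    rw [reducible_iff_of_isGround g₂] at hr₂
    refine ⟨_, by rw [Tm.bound_pair]; exact Part.mem_bind hd₁ (Part.mem_bind hd₂ (Part.mem_some _)),
      by simp [Ty.isGround, g₁, g₂], ?_⟩
    exact (vars_polyOf_append _ _).trans (Finset.union_subset hr₁ hr₂)
  | fst h ih =>
    obtain ⟨d, hd, hg, hr⟩ := ih hρ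
    simp only [Ty.isGround, Bool.and_eq_true] at hg
    exact ⟨d, by rwa [Tm.bound_fst], (reducible_iff_of_isGround hg.1).2 hr⟩
  | snd h ih =>
    obtain ⟨d, hd, hg, hr⟩ := ih hρ
    simp only [Ty.isGround, Bool.and_eq_true] at hg
    exact ⟨d, by rwa [Tm.bound_snd], (reducible_iff_of_isGround hg.2).2 hr⟩
  | inl h hs ih =>
    obtain ⟨d, hd, hr⟩ := ih hρ
    obtain ⟨g₁, g₂⟩ := hs.isGround
    exact ⟨d, by rwa [Tm.bound_inl], by simp [Ty.isGround, g₁, g₂],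
      (reducible_iff_of_isGround g₁).1 hr⟩
  | inr h hs ih =>
    obtain ⟨d, hd, hr⟩ := ih hρ
    obtain ⟨g₁, g₂⟩ := hs.isGround
    exact ⟨d, by rwa [Tm.bound_inr], by simp [Ty.isGround, g₁, g₂],
      (reducible_iff_of_isGround g₂).1 hr⟩
  | case h h₁ h₂ ih ih₁ ih₂ =>
    obtain ⟨d, hd, hg, hr⟩ := ih (hρ.mono Finset.subset_union_left)
    simp only [Ty.isGround, Bool.and_eq_true] at hg
    obtain ⟨d₁, hd₁, hr₁⟩ := ih₁ ((hρ.mono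
      (Finset.subset_union_left.trans Finset.subset_union_right)).cons
      ((reducible_iff_of_isGround hg.1).2 hr))
    obtain ⟨d₂, hd₂, hr₂⟩ := ih₂ ((hρ.mono
      (Finset.subset_union_right.trans Finset.subset_union_right)).cons
      ((reducible_iff_of_isGround hg.2).2 hr))
    refine ⟨_, ?_, hr₁.join hr₂⟩
    rw [Tm.bound_case]
    exact Part.mem_bind hd (Part.mem_bind hd₁ (Part.mem_bind hd₂ (Part.mem_some _)))
  | @con Γ m k F e hF h ih =>
    obtain ⟨d, hd, hr⟩ := ih hρ
    rw [reducible_iff_of_isGround (F.isGround_inst m rfl)] at hr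
    refine ⟨_, by rw [Tm.bound_con]; exact Part.mem_bind hd (Part.mem_some _), ?_⟩
    exact (vars_polyOf_cons_one _).trans hr
  | @des Γ m k F e hF h ih =>
    obtain ⟨d, hd, hr⟩ := ih hρ
    exact ⟨d, by rwa [Tm.bound_des], (reducible_iff_of_isGround (F.isGround_inst m rfl)).2 hr⟩
  | @fold Γ m k F f e σ hF hσ hf he ihf ihe =>
    have hg := Ty.isGround_of_isSafe hσ
    obtain ⟨d₁, hd₁, hr₁⟩ := ihf (hρ.mono Finset.subset_union_left)
    obtain ⟨d₂, hd₂, hr₂⟩ := ihe (hρ.mono Finset.subset_union_right)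
    obtain ⟨d₃, hd₃, hr₃⟩ := hr₁ (Bound.ground d₂.1)
      ((reducible_iff_of_isGround (F.isGround_inst m hg)).2 hr₂)
    rw [reducible_iff_of_isGround hg] at hr₃
    refine ⟨_, by rw [Tm.bound_fold]; exact Part.mem_bind hd₁ (Part.mem_bind hd₂
      (Part.mem_bind hd₃ (Part.mem_some _))), (reducible_iff_of_isGround hg).2 ?_⟩
    exact (vars_polyOf_mul _ _).trans (Finset.union_subset hr₂ hr₃)
  | lower hτ h hs ih =>
    obtain ⟨d, hd, hr⟩ := ih hρ
    have hg := Ty.isGround_of_isNormal hτ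
    exact ⟨d, hd, (reducible_iff_of_isGround hg).2
      ((reducible_iff_of_isGround (Ty.isGround_toSafe hg)).1 hr)⟩

/-! Determinism of evaluation -/

mutual

theorem Eval.unique {S : List PolyFunctor} : ∀ {θ : List Val} {e : Tm} {n n₁ n₂ : ℕ} {v w : Val},
    Eval S θ e n v n₁ → Eval S θ e n w n₂ → v = w ∧ n₁ = n₂
  | _, _, _, _, _, _, _, .var h, h' => by
    cases h' with | var h' => exact ⟨Option.some.inj (h.symm.trans h'), rfl⟩
  | _, _, _, _, _, _, _, .lam, h' => by cases h'; exact ⟨rfl, rfl⟩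
  | _, _, _, _, _, _, _, .app h₁ h₂ h₃, h' => by
    cases h' with | app h₁' h₂' h₃' =>
    obtain ⟨hv, rfl⟩ := h₁.unique h₁'
    cases hv
    obtain ⟨rfl, rfl⟩ := h₂.unique h₂'
    exact h₃.unique h₃'
  | _, _, _, _, _, _, _, .unit, h' => by cases h'; exact ⟨rfl, rfl⟩
  | _, _, _, _, _, _, _, .pair h₁ h₂, h' => by
    cases h' with | pair h₁' h₂' =>
    obtain ⟨rfl, rfl⟩ := h₁.unique h₁'
    obtain ⟨rfl, rfl⟩ := h₂.unique h₂'
    exact ⟨rfl, rfl⟩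
  | _, _, _, _, _, _, _, .fst h, h' => by
    cases h' with | fst h' =>
    obtain ⟨hv, rfl⟩ := h.unique h'
    cases hv
    exact ⟨rfl, rfl⟩
  | _, _, _, _, _, _, _, .snd h, h' => by
    cases h' with | snd h' =>
    obtain ⟨hv, rfl⟩ := h.unique h'
    cases hv
    exact ⟨rfl, rfl⟩
  | _, _, _, _, _, _, _, .inl h, h' => by
    cases h' with | inl h' =>
    obtain ⟨rfl, rfl⟩ := h.unique h'
    exact ⟨rfl, rfl⟩
  | _, _, _, _, _, _, _, .inr h, h' => by
    cases h' with | inr h' =>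
    obtain ⟨rfl, rfl⟩ := h.unique h'
    exact ⟨rfl, rfl⟩
  | _, _, _, _, _, _, _, .case_inl h₁ h₂, h' => by
    cases h' with
    | case_inl h₁' h₂' =>
      obtain ⟨hv, rfl⟩ := h₁.unique h₁'
      cases hv
      exact h₂.unique h₂'
    | case_inr h₁' h₂' => cases (h₁.unique h₁').1
  | _, _, _, _, _, _, _, .case_inr h₁ h₂, h' => by
    cases h' with
    | case_inl h₁' h₂' => cases (h₁.unique h₁').1
    | case_inr h₁' h₂' =>
      obtain ⟨hv, rfl⟩ := h₁.unique h₁'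
      cases hv
      exact h₂.unique h₂'
  | _, _, _, _, _, _, _, .con h, h' => by
    cases h' with | con h' =>
    obtain ⟨rfl, rfl⟩ := h.unique h'
    exact ⟨rfl, rfl⟩
  | _, _, _, _, _, _, _, .des h, h' => by
    cases h' with | des h' =>
    obtain ⟨hv, rfl⟩ := h.unique h'
    cases hv
    exact ⟨rfl, rfl⟩
  | _, _, _, _, _, _, _, .fold h₁ h₂, h' => by
    cases h' with | fold h₁' h₂' =>
    obtain ⟨rfl, rfl⟩ := h₁.unique h₁'
    obtain ⟨rfl, -, rfl⟩ := h₂.unique h₂'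
    exact ⟨rfl, rfl⟩

theorem FoldCell.unique {S : List PolyFunctor} : ∀ {θ : List Val} {k : ℕ} {f : Tm}
    {M M₁ M₂ : List (ℕ × Val)} {n n₁ n₂ : ℕ} {t v w : Val},
    FoldCell S θ k f M n t v M₁ n₁ → FoldCell S θ k f M n t w M₂ n₂ →
    v = w ∧ M₁ = M₂ ∧ n₁ = n₂
  | _, _, _, _, _, _, _, _, _, _, _, _, .hit h, h' => by
    cases h' with
    | hit h' => exact ⟨Option.some.inj (h.symm.trans h'), rfl, rfl⟩
    | miss h' => cases h.symm.trans h'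
  | _, _, _, _, _, _, _, _, _, _, _, _, .miss h hF h₁ h₂ h₃, h' => by
    cases h' with
    | hit h' => cases h.symm.trans h'
    | miss h' hF' h₁' h₂' h₃' =>
      cases hF.symm.trans hF'
      obtain ⟨hv, rfl⟩ := h₁.unique h₁'
      cases hv
      obtain ⟨rfl, rfl, rfl⟩ := h₂.unique h₂'
      obtain ⟨rfl, rfl⟩ := h₃.unique h₃'
      exact ⟨rfl, rfl, rfl⟩

theorem FoldMap.unique {S : List PolyFunctor} : ∀ {θ : List Val} {k : ℕ} {f : Tm}
    {F : PolyFunctor} {M M₁ M₂ : List (ℕ × Val)} {n n₁ n₂ : ℕ} {t v w : Val},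
    FoldMap S θ k f F M n t v M₁ n₁ → FoldMap S θ k f F M n t w M₂ n₂ →
    v = w ∧ M₁ = M₂ ∧ n₁ = n₂
  | _, _, _, _, _, _, _, _, _, _, _, _, _, .self h, h' => by
    cases h' with | self h' => exact h.unique h'
  | _, _, _, _, _, _, _, _, _, _, _, _, _, .unit, h' => by cases h'; exact ⟨rfl, rfl, rfl⟩
  | _, _, _, _, _, _, _, _, _, _, _, _, _, .data, h' => by cases h'; exact ⟨rfl, rfl, rfl⟩
  | _, _, _, _, _, _, _, _, _, _, _, _, _, .inl h, h' => by
    cases h' with | inl h' =>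
    obtain ⟨rfl, rfl, rfl⟩ := h.unique h'
    exact ⟨rfl, rfl, rfl⟩
  | _, _, _, _, _, _, _, _, _, _, _, _, _, .inr h, h' => by
    cases h' with | inr h' =>
    obtain ⟨rfl, rfl, rfl⟩ := h.unique h'
    exact ⟨rfl, rfl, rfl⟩
  | _, _, _, _, _, _, _, _, _, _, _, _, _, .pair h₁ h₂, h' => by
    cases h' with | pair h₁' h₂' =>
    obtain ⟨rfl, rfl, rfl⟩ := h₁.unique h₁'
    obtain ⟨rfl, rfl, rfl⟩ := h₂.unique h₂'
    exact ⟨rfl, rfl, rfl⟩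

end

/-! Values of ground type -/

/-- The types that agree up to modes have the same values. -/
theorem Val.HasTy.of_toSafe_eq {S : List PolyFunctor} {v : Val} {σ : Ty} (h : v.HasTy S σ) :
    ∀ {τ : Ty}, τ.toSafe = σ.toSafe → v.HasTy S τ := by
  induction h with
  | unit =>
    intro τ hτ
    cases τ <;> simp [Ty.toSafe] at hτ
    exact .unit
  | inl _ ih =>
    intro τ hτ
    cases τ <;> simp [Ty.toSafe] at hτ
    exact .inl (ih hτ.1)
  | inr _ ih =>
    intro τ hτ
    cases τ <;> simp [Ty.toSafe] at hτ
    exact .inr (ih hτ.2)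
  | pair _ _ ih₁ ih₂ =>
    intro τ hτ
    cases τ <;> simp [Ty.toSafe] at hτ
    exact .pair (ih₁ hτ.1) (ih₂ hτ.2)
  | cell hF _ ih =>
    intro τ hτ
    cases τ <;> simp [Ty.toSafe] at hτ
    subst hτ
    exact .cell hF (ih (by simp [PolyFunctor.toSafe_inst, Ty.toSafe]))

/-- No data cell is reachable from its contents. -/
def Val.Acyclic (v : Val) : Prop := ∀ k a w, v.Holds k a w → a ∉ w.cells

theorem Val.exists_holds : ∀ {v : Val} {a : ℕ}, a ∈ v.cells → ∃ k w, v.Holds k a w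
  | .unit, _, h => by simp [cells] at h
  | .inl v, _, h => exists_holds (v := v) (by simpa [cells] using h)
  | .inr v, _, h => exists_holds (v := v) (by simpa [cells] using h)
  | .pair v w, a, h => by
    simp only [cells, Finset.mem_union] at h
    rcases h with h | h
    · obtain ⟨k, u, hu⟩ := exists_holds h
      exact ⟨k, u, .inl hu⟩
    · obtain ⟨k, u, hu⟩ := exists_holds h
      exact ⟨k, u, .inr hu⟩
  | .cell k b v, a, h => by
    simp only [cells, Finset.mem_insert] at h
    rcases h with rfl | h
    · exact ⟨k, v, .inl ⟨rfl, rfl, rfl⟩⟩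
    · obtain ⟨k, u, hu⟩ := exists_holds h
      exact ⟨k, u, .inr hu⟩
  | .clo _ _, _, h => by simp [cells] at h

theorem Val.Holds.sizeOf_lt : ∀ {v : Val} {k a : ℕ} {w : Val}, v.Holds k a w → sizeOf w < sizeOf v
  | .unit, _, _, _, h => h.elim
  | .inl v, _, _, _, h => (sizeOf_lt (v := v) h).trans (by simp)
  | .inr v, _, _, _, h => (sizeOf_lt (v := v) h).trans (by simp)
  | .pair v w, _, _, _, h => by
    rcases h with h | h
    · exact (sizeOf_lt h).trans (by simp; omega)
    · exact (sizeOf_lt h).trans (by simp)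
  | .cell k b v, _, _, _, h => by
    rcases h with ⟨_, _, rfl⟩ | h
    · simp
    · exact (sizeOf_lt h).trans (by simp)
  | .clo _ _, _, _, _, h => h.elim

theorem Val.Holds.trans : ∀ {v : Val} {k a k' a' : ℕ} {w u : Val}, v.Holds k a w →
    w.Holds k' a' u → v.Holds k' a' u
  | .unit, _, _, _, _, _, _, h, _ => h.elim
  | .inl v, _, _, _, _, _, _, h, h' => trans (v := v) h h'
  | .inr v, _, _, _, _, _, _, h, h' => trans (v := v) h h'
  | .pair v w, _, _, _, _, _, _, h, h' => by
    rcases h with h | h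
    · exact .inl (h.trans h')
    · exact .inr (h.trans h')
  | .cell k b v, _, _, _, _, _, _, h, h' => by
    rcases h with ⟨_, _, rfl⟩ | h
    · exact .inr h'
    · exact .inr (h.trans h')
  | .clo _ _, _, _, _, _, _, _, h, _ => h.elim

/-- A value in which every address denotes one cell is acyclic. -/
theorem Val.acyclic_of_shared {v : Val} (h : ∀ a k₁ k₂ u₁ u₂, v.Holds k₁ a u₁ → v.Holds k₂ a u₂ →
    k₁ = k₂ ∧ u₁ = u₂) : v.Acyclic := by
  intro k a w hw ha
  obtain ⟨k', u, hu⟩ := exists_holds ha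
  obtain ⟨-, rfl⟩ := h a k k' w u hw (hw.trans hu)
  exact lt_irrefl _ hu.sizeOf_lt

/-- Acyclic values of type `σ` with all addresses below `n`. -/
structure Val.Good (S : List PolyFunctor) (σ : Ty) (n : ℕ) (v : Val) : Prop where
  typed : v.HasTy S σ
  acyclic : v.Acyclic
  fresh : ∀ a ∈ v.cells, a < n

namespace Val.Good

variable {S : List PolyFunctor} {σ τ : Ty} {n n' k a : ℕ} {v w : Val}

theorem mono (h : Good S σ n v) (hn : n ≤ n') : Good S σ n' v :=
  ⟨h.typed, h.acyclic, fun a ha => (h.fresh a ha).trans_le hn⟩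

theorem of_toSafe_eq (h : Good S σ n v) (hτ : τ.toSafe = σ.toSafe) : Good S τ n v :=
  ⟨h.typed.of_toSafe_eq hτ, h.acyclic, h.fresh⟩

theorem unit : Good S .unit n .unit := ⟨.unit, fun _ _ _ h => h.elim, by simp [cells]⟩

theorem inl (h : Good S σ n v) : Good S (.sum σ τ) n (.inl v) :=
  ⟨.inl h.typed, fun k a w hw => h.acyclic k a w hw, by simpa [cells] using h.fresh⟩

theorem inr (h : Good S τ n v) : Good S (.sum σ τ) n (.inr v) :=
  ⟨.inr h.typed, fun k a w hw => h.acyclic k a w hw, by simpa [cells] using h.fresh⟩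

theorem pair (hv : Good S σ n v) (hw : Good S τ n w) : Good S (.prod σ τ) n (.pair v w) := by
  refine ⟨.pair hv.typed hw.typed, fun k a w hw' => ?_, fun a ha => ?_⟩
  · exact hw'.elim (hv.acyclic k a w) (hw.acyclic k a w)
  · simp only [cells, Finset.mem_union] at ha
    exact ha.elim (hv.fresh a) (hw.fresh a)

theorem exists_of_sum (h : Good S (.sum σ τ) n v) :
    (∃ u, v = .inl u ∧ Good S σ n u) ∨ (∃ u, v = .inr u ∧ Good S τ n u) := by
  obtain ⟨ht, ha, hf⟩ := h
  cases ht with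
  | @inl u _ _ ht => exact .inl ⟨u, rfl, ht, fun k a w hw => ha k a w hw, by simpa [cells] using hf⟩
  | @inr u _ _ ht => exact .inr ⟨u, rfl, ht, fun k a w hw => ha k a w hw, by simpa [cells] using hf⟩

theorem exists_of_prod (h : Good S (.prod σ τ) n v) :
    ∃ u w, v = .pair u w ∧ Good S σ n u ∧ Good S τ n w := by
  obtain ⟨ht, ha, hf⟩ := h
  cases ht with
  | pair h₁ h₂ =>
    simp only [cells, Finset.mem_union] at hf
    exact ⟨_, _, rfl, ⟨h₁, fun k a w hw => ha k a w (.inl hw), fun a h => hf a (.inl h)⟩,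
      ⟨h₂, fun k a w hw => ha k a w (.inr hw), fun a h => hf a (.inr h)⟩⟩

theorem cell {m : Mode} {F : PolyFunctor} (hF : S[k]? = some F)
    (h : Good S (F.inst m (.data m k)) n v) : Good S (.data m k) (n + 1) (.cell k n v) := by
  refine ⟨.cell hF h.typed, fun j b w hw => ?_, fun b hb => ?_⟩
  · rcases hw with ⟨_, rfl, rfl⟩ | hw
    · exact fun hn => lt_irrefl _ (h.fresh _ hn)
    · exact h.acyclic j b w hw
  · simp only [cells, Finset.mem_insert] at hb
    rcases hb with rfl | hb
    · exact Nat.lt_succ_self _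
    · exact (h.fresh b hb).trans (Nat.lt_succ_self n)

theorem exists_of_data {m : Mode} {F : PolyFunctor} (hF : S[k]? = some F)
    (h : Good S (.data m k) n v) :
    ∃ a u, v = .cell k a u ∧ a ∉ u.cells ∧ Good S (F.inst m (.data m k)) n u := by
  obtain ⟨ht, ha, hf⟩ := h
  cases ht with
  | @cell _ _ a F' u hF' ht =>
    obtain rfl : F = F' := Option.some.inj (hF.symm.trans hF')
    simp only [cells, Finset.mem_insert] at hf
    exact ⟨a, u, rfl, ha k a u (.inl ⟨rfl, rfl, rfl⟩), ht, fun j b w hw => ha j b w (.inr hw),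
      fun b hb => hf b (.inr hb)⟩

end Val.Good

/-! Cells that count -/

/-- The cells in the representation of a value of ground type, without those cells from `A` that
occur at safe positions only. -/
def cellsMod (A : Finset ℕ) : Ty → Val → Finset ℕ
  | .data .normal _, v => v.cells
  | .data .safe _, v => v.cells \ A
  | .sum σ _, .inl v => cellsMod A σ v
  | .sum _ τ, .inr v => cellsMod A τ v
  | .prod σ τ, .pair v w => cellsMod A σ v ∪ cellsMod A τ w
  | _, _ => ∅

section CellsMod

variable {S : List PolyFunctor} {A B : Finset ℕ} {σ : Ty} {v : Val}

theorem cellsMod_of_isNormal (h : v.HasTy S σ) (hσ : σ.isNormal) : cellsMod A σ v = v.cells := by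
  induction h with
  | unit => simp [cellsMod, Val.cells]
  | inl _ ih | inr _ ih => simp_all [cellsMod, Val.cells, Ty.isNormal]
  | pair _ _ ih₁ ih₂ => simp_all [cellsMod, Val.cells, Ty.isNormal]
  | @cell m => cases m <;> simp_all [cellsMod, Ty.isNormal]

theorem cellsMod_of_isSafe (h : v.HasTy S σ) (hσ : σ.isSafe) : cellsMod A σ v = v.cells \ A := by
  induction h with
  | unit => simp [cellsMod, Val.cells]
  | inl _ ih | inr _ ih => simp_all [cellsMod, Val.cells, Ty.isSafe]
  | pair _ _ ih₁ ih₂ => simp_all [cellsMod, Val.cells, Ty.isSafe, Finset.union_sdiff_distrib]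
  | @cell m => cases m <;> simp_all [cellsMod, Ty.isSafe]

theorem cellsMod_subset (h : v.HasTy S σ) : cellsMod A σ v ⊆ v.cells := by
  induction h with
  | unit => simp [cellsMod]
  | inl _ ih | inr _ ih => simpa [cellsMod, Val.cells] using ih
  | pair _ _ ih₁ ih₂ => exact Finset.union_subset_union ih₁ ih₂
  | @cell m => cases m <;> simp [cellsMod]

theorem cells_subset_cellsMod_union (h : v.HasTy S σ) : v.cells ⊆ cellsMod A σ v ∪ A := by
  induction h with
  | unit => simp [Val.cells]
  | inl _ ih | inr _ ih => simpa [cellsMod, Val.cells] using ih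
  | pair _ _ ih₁ ih₂ =>
    refine Finset.union_subset (ih₁.trans ?_) (ih₂.trans ?_) <;>
    · intro a
      simp only [cellsMod, Finset.mem_union]
      tauto
  | @cell m =>
    cases m
    · simp [cellsMod]
    · simp [cellsMod]

theorem cellsMod_anti (h : v.HasTy S σ) (hAB : A ⊆ B) : cellsMod B σ v ⊆ cellsMod A σ v := by
  induction h with
  | unit => simp [cellsMod]
  | inl _ ih | inr _ ih => simpa [cellsMod] using ih
  | pair _ _ ih₁ ih₂ => exact Finset.union_subset_union ih₁ ih₂
  | @cell m =>
    cases m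
    · simp [cellsMod]
    · exact Finset.sdiff_subset_sdiff le_rfl hAB

theorem cellsMod_congr (h : v.HasTy S σ) (hσ : σ.deliversSafe = false) :
    cellsMod A σ v = cellsMod B σ v := by
  induction h with
  | unit => rfl
  | inl _ ih | inr _ ih => simp_all [cellsMod, Ty.deliversSafe]
  | pair _ _ ih₁ ih₂ => simp_all [cellsMod, Ty.deliversSafe]
  | @cell m => cases m <;> simp_all [cellsMod, Ty.deliversSafe]

theorem card_cellsMod_cell_le {m : Mode} {F : PolyFunctor} {k a : ℕ}
    (h : v.HasTy S (F.inst m (.data m k))) :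
    (cellsMod A (.data m k) (.cell k a v)).card ≤
      1 + (cellsMod A (F.inst m (.data m k)) v).card := by
  cases m with
  | normal =>
    rw [cellsMod_of_isNormal h (F.isNormal_inst rfl), add_comm]
    exact Finset.card_insert_le _ _
  | safe =>
    rw [cellsMod_of_isSafe h (F.isSafe_inst rfl), add_comm]
    refine le_trans (Finset.card_le_card ?_) (Finset.card_insert_le a _)
    intro b
    simp only [cellsMod, Val.cells, Finset.mem_sdiff, Finset.mem_insert]
    tauto

theorem cellsMod_content_subset {m : Mode} {F : PolyFunctor} {k a : ℕ}
    (h : v.HasTy S (F.inst m (.data m k))) :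
    cellsMod A (F.inst m (.data m k)) v ⊆ cellsMod A (.data m k) (.cell k a v) := by
  cases m with
  | normal =>
    rw [cellsMod_of_isNormal h (F.isNormal_inst rfl)]
    exact Finset.subset_insert _ _
  | safe =>
    rw [cellsMod_of_isSafe h (F.isSafe_inst rfl)]
    exact Finset.sdiff_subset_sdiff (Finset.subset_insert _ _) le_rfl

end CellsMod

/-! Memoized folds -/

/-- The cells of the results in a memo table. -/
def memoCells : List (ℕ × Val) → Finset ℕ
  | [] => ∅
  | p :: M => p.2.cells ∪ memoCells M

theorem cells_subset_memoCells {M : List (ℕ × Val)} {p : ℕ × Val} (h : p ∈ M) :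
    p.2.cells ⊆ memoCells M := by
  induction M with
  | nil => simp at h
  | cons q M ih =>
    rcases List.mem_cons.1 h with rfl | h
    · exact Finset.subset_union_left
    · exact (ih h).trans Finset.subset_union_right

theorem mem_of_lookup_eq_some {M : List (ℕ × Val)} {a : ℕ} {r : Val} (h : M.lookup a = some r) :
    (a, r) ∈ M := by
  induction M with
  | nil => simp at h
  | cons p M ih =>
    obtain ⟨b, w⟩ := p
    by_cases hab : a = b
    · subst hab
      simp at h
      simp [h]
    · rw [List.lookup_cons, beq_false_of_ne hab] at h
      exact List.mem_cons_of_mem _ (ih h)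

theorem not_mem_keys_of_lookup_eq_none {M : List (ℕ × Val)} {a : ℕ} (h : M.lookup a = none) :
    a ∉ M.map Prod.fst := by
  induction M with
  | nil => simp
  | cons p M ih =>
    obtain ⟨b, w⟩ := p
    by_cases hab : a = b
    · subst hab
      simp at h
    · rw [List.lookup_cons, beq_false_of_ne hab] at h
      simpa [hab] using ih h

/-- The memo table of a fold over cells in `T`: its results have type `σ`, and each of them brings
at most `K` new cells. -/
structure MemoInv (S : List PolyFunctor) (σ : Ty) (T A : Finset ℕ) (K n : ℕ)
    (M : List (ℕ × Val)) : Prop where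
  nodup : (M.map Prod.fst).Nodup
  keys : ∀ a ∈ M.map Prod.fst, a ∈ T
  good : ∀ p ∈ M, p.2.Good S σ n
  card : (memoCells M \ A).card ≤ M.length * K

theorem MemoInv.length_le {S : List PolyFunctor} {σ : Ty} {T A : Finset ℕ} {K n : ℕ}
    {M : List (ℕ × Val)} (h : MemoInv S σ T A K n M) : M.length ≤ T.card := by
  rw [← List.length_map (f := Prod.fst), ← List.toFinset_card_of_nodup h.nodup]
  exact Finset.card_le_card fun a ha => h.keys a (List.mem_toFinset.1 ha)

theorem MemoInv.mono {S : List PolyFunctor} {σ : Ty} {T A : Finset ℕ} {K n n' : ℕ}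
    {M : List (ℕ × Val)} (h : MemoInv S σ T A K n M) (hn : n ≤ n') : MemoInv S σ T A K n' M :=
  ⟨h.nodup, h.keys, fun p hp => (h.good p hp).mono hn, h.card⟩

theorem MemoInv.cons {S : List PolyFunctor} {σ : Ty} {T A : Finset ℕ} {K n a : ℕ}
    {M : List (ℕ × Val)} {r : Val} (h : MemoInv S σ T A K n M) (ha : a ∈ T)
    (hM : a ∉ M.map Prod.fst) (hr : r.Good S σ n)
    (hK : (r.cells \ (A ∪ memoCells M)).card ≤ K) : MemoInv S σ T A K n ((a, r) :: M) := by
  refine ⟨?_, ?_, ?_, ?_⟩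
  · simpa [List.nodup_cons] using ⟨by simpa using hM, h.nodup⟩
  · intro b hb
    rcases List.mem_cons.1 hb with rfl | hb
    · exact ha
    · exact h.keys b hb
  · intro p hp
    rcases List.mem_cons.1 hp with rfl | hp
    · exact hr
    · exact h.good p hp
  · have hsub : memoCells ((a, r) :: M) \ A ⊆
        (memoCells M \ A) ∪ (r.cells \ (A ∪ memoCells M)) := by
      intro b
      simp only [memoCells, Finset.mem_sdiff, Finset.mem_union]
      tauto
    refine (Finset.card_le_card hsub).trans ((Finset.card_union_le _ _).trans ?_)
    rw [List.length_cons, Nat.succ_mul]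
    exact Nat.add_le_add h.card hK

section Fold

variable {S : List PolyFunctor} {θ : List Val} {k : ℕ} {f : Tm} {F : PolyFunctor} {m : Mode}
  {σ : Ty} {T A : Finset ℕ} {K n₀ : ℕ}

/-- `f` evaluates to a function which, on arguments whose cells lie in `T` up to cells at safe
positions, gives results with at most `K` new cells. -/
def StepBounded (S : List PolyFunctor) (θ : List Val) (f : Tm) (ρ σ : Ty) (T A : Finset ℕ)
    (K n₀ : ℕ) : Prop :=
  ∀ n, n₀ ≤ n → ∃ e θ₀ n₁, Eval S θ f n (.clo e θ₀) n₁ ∧ n ≤ n₁ ∧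
    ∀ B n₂ w, A ⊆ B → n₁ ≤ n₂ → w.Good S ρ n₂ → cellsMod B ρ w ⊆ T →
      ∃ r n₃, Eval S (w :: θ₀) e n₂ r n₃ ∧ n₂ ≤ n₃ ∧ r.Good S σ n₃ ∧ (r.cells \ B).card ≤ K

/-- The outcome of a fold or of the action of a functor on it, where `M` is the memo table before
and `M₁` the one after. -/
structure FoldOutcome (S : List PolyFunctor) (ρ σ : Ty) (T A C : Finset ℕ) (K n : ℕ)
    (M : List (ℕ × Val)) (w : Val) (M₁ : List (ℕ × Val)) (n₁ : ℕ) : Prop where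
  le : n ≤ n₁
  inv : MemoInv S σ T A K n₁ M₁
  subset : memoCells M ⊆ memoCells M₁
  keys : ∀ a ∈ M₁.map Prod.fst, a ∈ M.map Prod.fst ∨ a ∈ C
  good : w.Good S ρ n₁
  cellsMod_subset : ∀ B, memoCells M₁ ⊆ B → cellsMod B ρ w ⊆ T

theorem exists_foldMap (hF : S[k]? = some F) (hσ : σ.isSafe)
    (hf : StepBounded S θ f (F.inst m σ) σ T A K n₀) {v : Val} {ρ : Ty} (hv : v.HasTy S ρ) :
    ∀ (G : PolyFunctor), ρ = G.inst .normal (.data .normal k) →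
    ∀ (M : List (ℕ × Val)) (n : ℕ), n₀ ≤ n → MemoInv S σ T A K n M → v.cells ⊆ T →
    v.Good S ρ n → ∃ w M₁ n₁, FoldMap S θ k f G M n v w M₁ n₁ ∧
      FoldOutcome S (G.inst m σ) σ T A v.cells K n M w M₁ n₁ := by
  have hdata {j n : ℕ} {M : List (ℕ × Val)} {v : Val} (hM : MemoInv S σ T A K n M)
      (hT : v.cells ⊆ T) (hg : v.Good S (.data .normal j) n) :
      FoldOutcome S (.data m j) σ T A v.cells K n M v M n := by
    refine ⟨le_rfl, hM, subset_rfl, fun a ha => .inl ha, hg.of_toSafe_eq rfl, fun B _ => ?_⟩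
    exact (cellsMod_subset (hg.of_toSafe_eq (τ := .data m j) rfl).typed).trans hT
  induction hv with
  | unit =>
    rintro (_ | _ | _ | _ | _) hG M n hn hM hT hg <;> simp [PolyFunctor.inst] at hG
    exact ⟨_, _, _, .unit, le_rfl, hM, subset_rfl, fun a ha => .inl ha, hg, fun B _ => by
      simp [PolyFunctor.inst, cellsMod]⟩
  | @inl v σ₁ σ₂ _ ih =>
    rintro (_ | _ | _ | ⟨G, H⟩ | _) hG M n hn hM hT hg <;> simp [PolyFunctor.inst] at hG
    obtain ⟨_, hv, hg⟩ | ⟨_, hv, hg⟩ := hg.exists_of_sum <;> cases hv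
    obtain ⟨w, M₁, n₁, hw, ho⟩ := ih G hG.1 M n hn hM hT hg
    exact ⟨_, _, _, .inl hw, ho.le, ho.inv, ho.subset, ho.keys, ho.good.inl, ho.cellsMod_subset⟩
  | @inr v σ₁ σ₂ _ ih =>
    rintro (_ | _ | _ | ⟨G, H⟩ | _) hG M n hn hM hT hg <;> simp [PolyFunctor.inst] at hG
    obtain ⟨_, hv, hg⟩ | ⟨_, hv, hg⟩ := hg.exists_of_sum <;> cases hv
    obtain ⟨w, M₁, n₁, hw, ho⟩ := ih H hG.2 M n hn hM hT hg
    exact ⟨_, _, _, .inr hw, ho.le, ho.inv, ho.subset, ho.keys, ho.good.inr, ho.cellsMod_subset⟩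
  | @pair v₁ v₂ σ₁ σ₂ _ _ ih₁ ih₂ =>
    rintro (_ | _ | _ | _ | ⟨G, H⟩) hG M n hn hM hT hg <;> simp [PolyFunctor.inst] at hG
    obtain ⟨_, _, hv, hg₁, hg₂⟩ := hg.exists_of_prod
    cases hv
    obtain ⟨w₁, M₁, n₁, hw₁, ho₁⟩ :=
      ih₁ G hG.1 M n hn hM (Finset.subset_union_left.trans hT) hg₁
    obtain ⟨w₂, M₂, n₂, hw₂, ho₂⟩ := ih₂ H hG.2 M₁ n₁ (hn.trans ho₁.le) ho₁.inv
      (Finset.subset_union_right.trans hT) (hg₂.mono ho₁.le)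
    refine ⟨_, _, _, .pair hw₁ hw₂, ho₁.le.trans ho₂.le, ho₂.inv, ho₁.subset.trans ho₂.subset,
      fun a ha => ?_, (ho₁.good.mono ho₂.le).pair ho₂.good, fun B hB => ?_⟩
    · simp only [Val.cells, Finset.mem_union]
      rcases ho₂.keys a ha with ha | ha
      · rcases ho₁.keys a ha with ha | ha <;> tauto
      · tauto
    · exact Finset.union_subset (ho₁.cellsMod_subset B (ho₂.subset.trans hB))
        (ho₂.cellsMod_subset B hB)
  | @cell m' j a F' v hF' _ ih =>
    rintro (_ | _ | j' | _ | _) hG M n hn hM hT hg <;> simp [PolyFunctor.inst] at hG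
    · obtain ⟨rfl, rfl⟩ := hG
      obtain rfl : F = F' := Option.some.inj (hF.symm.trans hF')
      suffices ∃ w M₁ n₁, FoldCell S θ j f M n (.cell j a v) w M₁ n₁ ∧ n ≤ n₁ ∧
          MemoInv S σ T A K n₁ M₁ ∧ memoCells M ⊆ memoCells M₁ ∧
          (∀ b ∈ M₁.map Prod.fst, b ∈ M.map Prod.fst ∨ b ∈ (Val.cell j a v).cells) ∧
          ∃ b, (b, w) ∈ M₁ by
        obtain ⟨w, M₁, n₁, hw, hle, hinv, hsub, hkeys, b, hb⟩ := this
        have hwg := hinv.good _ hb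
        refine ⟨w, M₁, n₁, .self hw, hle, hinv, hsub, hkeys, hwg, fun B hB => ?_⟩
        rw [PolyFunctor.inst, cellsMod_of_isSafe hwg.typed hσ,
          Finset.sdiff_eq_empty_iff_subset.2 ((cells_subset_memoCells hb).trans hB)]
        exact Finset.empty_subset _
      cases hl : M.lookup a with
      | some r =>
        exact ⟨r, M, n, .hit hl, le_rfl, hM, subset_rfl, fun b hb => .inl hb, a,
          mem_of_lookup_eq_some hl⟩
      | none =>
        obtain ⟨_, _, hv, hav, hg⟩ := hg.exists_of_data hF
        cases hv
        obtain ⟨e, θ₀, n₁, he, hn₁, hstep⟩ := hf n hn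
        obtain ⟨w, M₁, n₂, hw, ho⟩ := ih F rfl M n₁ (hn.trans hn₁) (hM.mono hn₁)
          ((Finset.subset_insert _ _).trans hT) (hg.mono hn₁)
        obtain ⟨r, n₃, hr, hn₃, hrg, hK⟩ := hstep (A ∪ memoCells M₁) n₂ w
          Finset.subset_union_left ho.le ho.good (ho.cellsMod_subset _ Finset.subset_union_right)
        have haM : a ∉ M₁.map Prod.fst := fun h =>
          (ho.keys a h).elim (not_mem_keys_of_lookup_eq_none hl) hav
        refine ⟨r, (a, r) :: M₁, n₃, .miss hl hF he hw hr, hn₁.trans (ho.le.trans hn₃),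
          (ho.inv.mono hn₃).cons (hT (Finset.mem_insert_self _ _)) haM hrg hK,
          ho.subset.trans Finset.subset_union_right, fun b hb => ?_, a, List.mem_cons_self⟩
        simp only [Val.cells, Finset.mem_insert]
        rcases List.mem_cons.1 hb with rfl | hb
        · exact .inr (.inl rfl)
        · rcases ho.keys b hb with hb | hb <;> tauto
    · obtain ⟨rfl, rfl⟩ := hG
      exact ⟨_, _, _, .data, hdata hM hT hg⟩

theorem exists_foldCell (hF : S[k]? = some F) (hσ : σ.isSafe) {t : Val}
    (hf : StepBounded S θ f (F.inst m σ) σ t.cells A K n₀) (ht : t.Good S (.data .normal k) n₀) :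
    ∃ r M n, FoldCell S θ k f [] n₀ t r M n ∧ n₀ ≤ n ∧ r.Good S σ n ∧
      (r.cells \ A).card ≤ t.cells.card * K := by
  obtain ⟨r, M, n, hr, ho⟩ := exists_foldMap hF hσ hf ht.typed .self rfl [] n₀ le_rfl
    ⟨by simp, by simp, by simp, by simp [memoCells]⟩ subset_rfl ht
  cases hr with | self hr =>
  refine ⟨r, M, n, hr, ho.le, ho.good, ?_⟩
  have hrM : r.cells ⊆ memoCells M := by
    cases hr with
    | hit h => cases h
    | miss => exact Finset.subset_union_left
  exact (Finset.card_le_card (Finset.sdiff_subset_sdiff hrM le_rfl)).trans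
    (ho.inv.card.trans (Nat.mul_le_mul_right K ho.inv.length_le))

end Fold

/-! The logical relation between values and their bounds -/

/-- A value of ground type with at most as many cells outside `A` as the polynomial `p` says. -/
structure GroundRel (S : List PolyFunctor) (s : ℕ → ℕ) (σ : Ty) (A : Finset ℕ) (n : ℕ) (v : Val)
    (p : PolyList) : Prop where
  good : v.Good S σ n
  card : (cellsMod A σ v).card ≤ MvPolynomial.eval s (polyOf p)

/-- The value `v` of type `τ` is bounded by `d`, where the variables of polynomials have the
values `s`, cells in `A` at safe positions do not count, and `n` is the first unused address. -/
def Rel (S : List PolyFunctor) (V : Finset ℕ) (s : ℕ → ℕ) :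
    Ty → Finset ℕ → ℕ → Val → Bound → Prop
  | .unit, A, n, v, d => GroundRel S s .unit A n v d.1
  | .data m k, A, n, v, d => GroundRel S s (.data m k) A n v d.1
  | .sum σ τ, A, n, v, d => (Ty.sum σ τ).isGround ∧ GroundRel S s (.sum σ τ) A n v d.1
  | .prod σ τ, A, n, v, d => (Ty.prod σ τ).isGround ∧ GroundRel S s (.prod σ τ) A n v d.1
  | .arrow σ τ, A, n, w, d => ∃ e θ₀, w = .clo e θ₀ ∧ ∀ A' n' v a b, A ⊆ A' → n ≤ n' →
      Reducible V σ a → Rel S V s σ A' n' v a → b ∈ d.app a →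
      ∃ r n'', Eval S (v :: θ₀) e n' r n'' ∧ n' ≤ n'' ∧ Rel S V s τ A' n'' r b

section Rel

variable {S : List PolyFunctor} {V : Finset ℕ} {s : ℕ → ℕ} {σ τ : Ty} {A A' : Finset ℕ}
  {n n' : ℕ} {v : Val} {d : Bound}

theorem GroundRel.mono {p : PolyList} (h : GroundRel S s σ A n v p) (hA : A ⊆ A') (hn : n ≤ n') :
    GroundRel S s σ A' n' v p :=
  ⟨h.good.mono hn, (Finset.card_le_card (cellsMod_anti h.good.typed hA)).trans h.card⟩

theorem rel_iff_of_isGround (h : σ.isGround) :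
    Rel S V s σ A n v d ↔ GroundRel S s σ A n v d.1 := by
  cases σ with
  | unit | data => rfl
  | sum | prod => simp [Rel, h]
  | arrow => simp [Ty.isGround] at h

theorem Rel.mono (h : Rel S V s σ A n v d) (hA : A ⊆ A') (hn : n ≤ n') :
    Rel S V s σ A' n' v d := by
  cases σ with
  | unit | data => exact GroundRel.mono h hA hn
  | sum | prod => exact ⟨h.1, h.2.mono hA hn⟩
  | arrow σ τ =>
    obtain ⟨e, θ₀, rfl, h⟩ := h
    exact ⟨e, θ₀, rfl, fun A'' n'' v a b hA' hn' => h A'' n'' v a b (hA.trans hA') (hn.trans hn')⟩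

theorem GroundRel.congr {p : PolyList} (h : GroundRel S s σ A n v p)
    (hσ : σ.deliversSafe = false) (A' : Finset ℕ) : GroundRel S s σ A' n v p :=
  ⟨h.good, by rw [cellsMod_congr h.good.typed hσ]; exact h.card⟩

theorem Rel.congr (h : Rel S V s σ A n v d) (hσ : σ.deliversSafe = false) (A' : Finset ℕ) :
    Rel S V s σ A' n v d := by
  induction σ generalizing A A' n v d with
  | unit | data => exact GroundRel.congr h hσ A'
  | sum | prod => exact ⟨h.1, h.2.congr hσ A'⟩
  | arrow σ τ _ ih =>
    obtain ⟨e, θ₀, rfl, h⟩ := h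
    refine ⟨e, θ₀, rfl, fun B n' v a b hB hn ha hv hb => ?_⟩
    obtain ⟨r, n'', hr, hn', hrel⟩ := h (A ∪ B) n' v a b Finset.subset_union_left hn ha
      (hv.mono Finset.subset_union_right le_rfl) hb
    exact ⟨r, n'', hr, hn', ih hrel hσ B⟩

theorem eval_polyOf_append (p q : PolyList) : MvPolynomial.eval s (polyOf (p ++ q)) =
    MvPolynomial.eval s (polyOf p) + MvPolynomial.eval s (polyOf q) := by
  rw [polyOf_append, map_add]

theorem Rel.join_left {d₁ d₂ : Bound} (h : Rel S V s σ A n v d₁) (h₂ : Reducible V σ d₂) :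
    Rel S V s σ A n v (d₁.join d₂) := by
  have hground {σ : Ty} {p q : PolyList} {A : Finset ℕ} {n : ℕ} {v : Val}
      (h : GroundRel S s σ A n v p) : GroundRel S s σ A n v (p ++ q) :=
    ⟨h.good, h.card.trans (by rw [eval_polyOf_append]; exact Nat.le_add_right _ _)⟩
  induction σ generalizing A n v d₁ d₂ with
  | unit | data => exact hground h
  | sum | prod => exact ⟨h.1, hground h.2⟩
  | arrow σ τ _ ih =>
    obtain ⟨e, θ₀, rfl, h⟩ := h
    refine ⟨e, θ₀, rfl, fun B n' v a b hB hn ha hv hb => ?_⟩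
    rw [Bound.join_app] at hb
    obtain ⟨b₁, hb₁, hb⟩ := Part.mem_bind_iff.1 hb
    obtain ⟨b₂, hb₂, hb⟩ := Part.mem_bind_iff.1 hb
    obtain rfl := Part.mem_some_iff.1 hb
    obtain ⟨b₂', hb₂', hr₂⟩ := h₂ a ha
    obtain rfl := Part.mem_unique hb₂ hb₂'
    obtain ⟨r, n'', hr, hn', hrel⟩ := h B n' v a b₁ hB hn ha hv hb₁
    exact ⟨r, n'', hr, hn', ih hrel hr₂⟩

theorem Rel.join_right {d₁ d₂ : Bound} (h : Rel S V s σ A n v d₂) (h₁ : Reducible V σ d₁) :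
    Rel S V s σ A n v (d₁.join d₂) := by
  have hground {σ : Ty} {p q : PolyList} {A : Finset ℕ} {n : ℕ} {v : Val}
      (h : GroundRel S s σ A n v q) : GroundRel S s σ A n v (p ++ q) :=
    ⟨h.good, h.card.trans (by rw [eval_polyOf_append]; exact Nat.le_add_left _ _)⟩
  induction σ generalizing A n v d₁ d₂ with
  | unit | data => exact hground h
  | sum | prod => exact ⟨h.1, hground h.2⟩
  | arrow σ τ _ ih =>
    obtain ⟨e, θ₀, rfl, h⟩ := h
    refine ⟨e, θ₀, rfl, fun B n' v a b hB hn ha hv hb => ?_⟩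
    rw [Bound.join_app] at hb
    obtain ⟨b₁, hb₁, hb⟩ := Part.mem_bind_iff.1 hb
    obtain ⟨b₂, hb₂, hb⟩ := Part.mem_bind_iff.1 hb
    obtain rfl := Part.mem_some_iff.1 hb
    obtain ⟨b₁', hb₁', hr₁⟩ := h₁ a ha
    obtain rfl := Part.mem_unique hb₁ hb₁'
    obtain ⟨r, n'', hr, hn', hrel⟩ := h B n' v a b₂ hB hn ha hv hb₂
    exact ⟨r, n'', hr, hn', ih hrel hr₁⟩

end Rel

/-- The variables in `X` have values that are bounded by their bounds in `ρ`. -/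
def RelEnv (S : List PolyFunctor) (V : Finset ℕ) (s : ℕ → ℕ) (Γ : List Ty) (X A : Finset ℕ)
    (n : ℕ) (θ : List Val) (ρ : List Bound) : Prop :=
  ∀ x ∈ X, ∃ σ v d, Γ[x]? = some σ ∧ θ[x]? = some v ∧ ρ[x]? = some d ∧ Reducible V σ d ∧
    Rel S V s σ A n v d

section RelEnv

variable {S : List PolyFunctor} {V : Finset ℕ} {s : ℕ → ℕ} {Γ : List Ty} {X Y A A' : Finset ℕ}
  {n n' : ℕ} {θ : List Val} {ρ : List Bound}

theorem RelEnv.reducibleEnv (h : RelEnv S V s Γ X A n θ ρ) : ReducibleEnv V Γ X ρ := by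
  intro x hx
  obtain ⟨σ, v, d, hσ, -, hd, hr, -⟩ := h x hx
  exact ⟨σ, d, hσ, hd, hr⟩

theorem RelEnv.mono (h : RelEnv S V s Γ Y A n θ ρ) (hXY : X ⊆ Y) (hA : A ⊆ A') (hn : n ≤ n') :
    RelEnv S V s Γ X A' n' θ ρ := by
  intro x hx
  obtain ⟨σ, v, d, hσ, hv, hd, hr, hrel⟩ := h x (hXY hx)
  exact ⟨σ, v, d, hσ, hv, hd, hr, hrel.mono hA hn⟩

theorem RelEnv.cons {σ : Ty} {v : Val} {a : Bound} (h : RelEnv S V s Γ (unbind X) A n θ ρ)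
    (ha : Reducible V σ a) (hv : Rel S V s σ A n v a) :
    RelEnv S V s (σ :: Γ) X A n (v :: θ) (a :: ρ) := by
  intro x hx
  cases x with
  | zero => exact ⟨σ, v, a, rfl, rfl, rfl, ha, hv⟩
  | succ x => exact h x (succ_mem_iff_mem_unbind.2 hx)

theorem RelEnv.congr_of_sfv_eq_empty {e : Tm} (h : RelEnv S V s Γ e.fv A n θ ρ)
    (he : sfv Γ e = ∅) (A' : Finset ℕ) : RelEnv S V s Γ e.fv A' n θ ρ := by
  intro x hx
  obtain ⟨σ, v, d, hσ, hv, hd, hr, hrel⟩ := h x hx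
  refine ⟨σ, v, d, hσ, hv, hd, hr, hrel.congr ?_ A'⟩
  have := Finset.filter_eq_empty_iff.1 he hx
  simpa [hσ] using this

end RelEnv

/-- Terms of `RS` have values that respect the bounds computed by the interpreter. -/
theorem HasType.exists_eval {S : List PolyFunctor} {V : Finset ℕ} {s : ℕ → ℕ} {Γ : List Ty}
    {e : Tm} {τ : Ty} (h : HasType S Γ e τ) {A : Finset ℕ} {n : ℕ} {θ : List Val}
    {ρ : List Bound} (hθ : RelEnv S V s Γ e.fv A n θ ρ) {d : Bound} (hd : d ∈ e.bound ρ) :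
    ∃ v n₁, Eval S θ e n v n₁ ∧ n ≤ n₁ ∧ Rel S V s τ A n₁ v d := by
  induction h generalizing A n θ ρ d with
  | @var Γ i τ hi =>
    obtain ⟨σ, v, d', hσ, hv, hd', hr, hrel⟩ := hθ i (by simp [Tm.fv])
    obtain rfl : τ = σ := Option.some.inj (hi.symm.trans hσ)
    obtain rfl : d = d' := by
      rw [Tm.bound_var, hd'] at hd
      exact Part.mem_some_iff.1 hd
    exact ⟨v, n, .var hv, le_rfl, hrel⟩
  | @lam Γ e σ τ h ih =>
    rw [Tm.bound_lam] at hd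
    obtain rfl := Part.mem_some_iff.1 hd
    refine ⟨_, n, .lam, le_rfl, e, θ, rfl, fun B n' v a b hB hn ha hv hb => ?_⟩
    rw [Tm.lamBound_app] at hb
    exact ih ((hθ.mono subset_rfl hB hn).cons ha hv) hb
  | app h₁ h₂ ih₁ ih₂ =>
    rw [Tm.bound_app] at hd
    obtain ⟨d₁, hd₁, hd⟩ := Part.mem_bind_iff.1 hd
    obtain ⟨d₂, hd₂, hd⟩ := Part.mem_bind_iff.1 hd
    have hθ₂ := hθ.mono Finset.subset_union_right subset_rfl le_rfl
    obtain ⟨_, n₁, he₁, hn₁, e, θ₀, rfl, hrel₁⟩ :=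
      ih₁ (hθ.mono Finset.subset_union_left subset_rfl le_rfl) hd₁
    obtain ⟨v, n₂, he₂, hn₂, hrel₂⟩ := ih₂ (hθ₂.mono subset_rfl subset_rfl hn₁) hd₂
    obtain ⟨d₂', hd₂', hr₂⟩ := h₂.exists_bound hθ₂.reducibleEnv
    obtain rfl := Part.mem_unique hd₂ hd₂'
    obtain ⟨r, n₃, he₃, hn₃, hrel⟩ := hrel₁ A n₂ v d₂ d subset_rfl hn₂ hr₂ hrel₂ hd
    exact ⟨r, n₃, .app he₁ he₂ he₃, hn₁.trans (hn₂.trans hn₃), hrel⟩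
  | unit => exact ⟨_, n, .unit, le_rfl, .unit, by simp [cellsMod]⟩
  | @pair Γ e₁ e₂ σ τ h₁ h₂ hs ih₁ ih₂ =>
    rw [Tm.bound_pair] at hd
    obtain ⟨d₁, hd₁, hd⟩ := Part.mem_bind_iff.1 hd
    obtain ⟨d₂, hd₂, hd⟩ := Part.mem_bind_iff.1 hd
    obtain rfl := Part.mem_some_iff.1 hd
    obtain ⟨v, n₁, he₁, hn₁, hrel₁⟩ :=
      ih₁ (hθ.mono Finset.subset_union_left subset_rfl le_rfl) hd₁
    obtain ⟨w, n₂, he₂, hn₂, hrel₂⟩ := ih₂ (hθ.mono Finset.subset_union_right subset_rfl hn₁) hd₂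
    obtain ⟨g₁, g₂⟩ := hs.isGround
    rw [rel_iff_of_isGround g₁] at hrel₁
    rw [rel_iff_of_isGround g₂] at hrel₂
    refine ⟨_, n₂, .pair he₁ he₂, hn₁.trans hn₂, by simp [Ty.isGround, g₁, g₂],
      (hrel₁.good.mono hn₂).pair hrel₂.good, ?_⟩
    rw [Bound.ground, eval_polyOf_append]
    exact (Finset.card_union_le _ _).trans (Nat.add_le_add hrel₁.card hrel₂.card)
  | fst h ih =>
    rw [Tm.bound_fst] at hd
    obtain ⟨_, n₁, he, hn, hg, hrel⟩ := ih hθ hd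
    simp only [Ty.isGround, Bool.and_eq_true] at hg
    obtain ⟨v, w, rfl, hv, hw⟩ := hrel.good.exists_of_prod
    exact ⟨v, n₁, .fst he, hn, (rel_iff_of_isGround hg.1).2
      ⟨hv, (Finset.card_le_card Finset.subset_union_left).trans hrel.card⟩⟩
  | snd h ih =>
    rw [Tm.bound_snd] at hd
    obtain ⟨_, n₁, he, hn, hg, hrel⟩ := ih hθ hd
    simp only [Ty.isGround, Bool.and_eq_true] at hg
    obtain ⟨v, w, rfl, hv, hw⟩ := hrel.good.exists_of_prod
    exact ⟨w, n₁, .snd he, hn, (rel_iff_of_isGround hg.2).2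
      ⟨hw, (Finset.card_le_card Finset.subset_union_right).trans hrel.card⟩⟩
  | inl h hs ih =>
    rw [Tm.bound_inl] at hd
    obtain ⟨v, n₁, he, hn, hrel⟩ := ih hθ hd
    obtain ⟨g₁, g₂⟩ := hs.isGround
    rw [rel_iff_of_isGround g₁] at hrel
    exact ⟨_, n₁, .inl he, hn, by simp [Ty.isGround, g₁, g₂], hrel.good.inl, hrel.card⟩
  | inr h hs ih =>
    rw [Tm.bound_inr] at hd
    obtain ⟨v, n₁, he, hn, hrel⟩ := ih hθ hd
    obtain ⟨g₁, g₂⟩ := hs.isGround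
    rw [rel_iff_of_isGround g₂] at hrel
    exact ⟨_, n₁, .inr he, hn, by simp [Ty.isGround, g₁, g₂], hrel.good.inr, hrel.card⟩
  | @case Γ e e₁ e₂ σ₁ σ₂ τ h h₁ h₂ ih ih₁ ih₂ =>
    rw [Tm.bound_case] at hd
    obtain ⟨d₀, hd₀, hd⟩ := Part.mem_bind_iff.1 hd
    obtain ⟨d₁, hd₁, hd⟩ := Part.mem_bind_iff.1 hd
    obtain ⟨d₂, hd₂, hd⟩ := Part.mem_bind_iff.1 hd
    obtain rfl := Part.mem_some_iff.1 hd
    have hθ₀ := hθ.mono Finset.subset_union_left subset_rfl le_rfl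
    have hθ₁ := hθ.mono (Finset.subset_union_left.trans Finset.subset_union_right)
      subset_rfl le_rfl
    have hθ₂ := hθ.mono (Finset.subset_union_right.trans Finset.subset_union_right)
      subset_rfl le_rfl
    obtain ⟨d₀', hd₀', -, hr₀⟩ := h.exists_bound hθ₀.reducibleEnv
    obtain rfl := Part.mem_unique hd₀ hd₀'
    obtain ⟨v₀, n₁, he, hn₁, hg, hrel⟩ := ih hθ₀ hd₀
    simp only [Ty.isGround, Bool.and_eq_true] at hg
    have hσ₁ := (reducible_iff_of_isGround hg.1).2 hr₀
    have hσ₂ := (reducible_iff_of_isGround hg.2).2 hr₀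
    obtain ⟨d₁', hd₁', hr₁⟩ := h₁.exists_bound (hθ₁.reducibleEnv.cons hσ₁)
    obtain ⟨d₂', hd₂', hr₂⟩ := h₂.exists_bound (hθ₂.reducibleEnv.cons hσ₂)
    obtain rfl := Part.mem_unique hd₁ hd₁'
    obtain rfl := Part.mem_unique hd₂ hd₂'
    obtain ⟨v, rfl, hv⟩ | ⟨v, rfl, hv⟩ := hrel.good.exists_of_sum
    · obtain ⟨r, n₂, he₁, hn₂, hrel₁⟩ := ih₁ ((hθ₁.mono subset_rfl subset_rfl hn₁).cons hσ₁
        ((rel_iff_of_isGround hg.1).2 ⟨hv, hrel.card⟩)) hd₁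
      exact ⟨r, n₂, .case_inl he he₁, hn₁.trans hn₂, hrel₁.join_left hr₂⟩
    · obtain ⟨r, n₂, he₂, hn₂, hrel₂⟩ := ih₂ ((hθ₂.mono subset_rfl subset_rfl hn₁).cons hσ₂
        ((rel_iff_of_isGround hg.2).2 ⟨hv, hrel.card⟩)) hd₂
      exact ⟨r, n₂, .case_inr he he₂, hn₁.trans hn₂, hrel₂.join_right hr₁⟩
  | @con Γ m k F e hF h ih =>
    rw [Tm.bound_con] at hd
    obtain ⟨d₀, hd₀, hd⟩ := Part.mem_bind_iff.1 hd
    obtain rfl := Part.mem_some_iff.1 hd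
    obtain ⟨v, n₁, he, hn, hrel⟩ := ih hθ hd₀
    rw [rel_iff_of_isGround (F.isGround_inst m rfl)] at hrel
    refine ⟨_, _, .con he, hn.trans (Nat.le_succ _), hrel.good.cell hF, ?_⟩
    rw [Bound.ground, polyOf_cons_one, map_add, map_one]
    exact (card_cellsMod_cell_le hrel.good.typed).trans (Nat.add_le_add_left hrel.card 1)
  | @des Γ m k F e hF h ih =>
    rw [Tm.bound_des] at hd
    obtain ⟨_, n₁, he, hn, hrel⟩ := ih hθ hd
    obtain ⟨a, v, rfl, -, hv⟩ := hrel.good.exists_of_data hF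
    exact ⟨v, n₁, .des he, hn, (rel_iff_of_isGround (F.isGround_inst m rfl)).2
      ⟨hv, (Finset.card_le_card (cellsMod_content_subset hv.typed)).trans hrel.card⟩⟩
  | @fold Γ m k F f e σ hF hσ hf he ihf ihe =>
    have hg := Ty.isGround_of_isSafe hσ
    have hgF := F.isGround_inst m hg
    rw [Tm.bound_fold] at hd
    obtain ⟨d₁, hd₁, hd⟩ := Part.mem_bind_iff.1 hd
    obtain ⟨d₂, hd₂, hd⟩ := Part.mem_bind_iff.1 hd
    obtain ⟨d₃, hd₃, hd⟩ := Part.mem_bind_iff.1 hd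
    obtain rfl := Part.mem_some_iff.1 hd
    have hθ₁ := hθ.mono Finset.subset_union_left subset_rfl le_rfl
    have hθ₂ := hθ.mono Finset.subset_union_right subset_rfl le_rfl
    obtain ⟨d₂', hd₂', hr₂⟩ := he.exists_bound hθ₂.reducibleEnv
    obtain rfl := Part.mem_unique hd₂ hd₂'
    obtain ⟨t, n₁, het, hn₁, ht⟩ := ihe hθ₂ hd₂
    have hstep : StepBounded S θ f (F.inst m σ) σ t.cells A
        (MvPolynomial.eval s (polyOf d₃.1)) n₁ := by
      intro n hn
      obtain ⟨_, n₂, hef, hn₂, e', θ₀, rfl, hrel⟩ :=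
        ihf (hθ₁.mono subset_rfl subset_rfl (hn₁.trans hn)) hd₁
      refine ⟨e', θ₀, n₂, hef, hn₂, fun B n' w hB hn' hw hwt => ?_⟩
      obtain ⟨r, n₃, hr, hn₃, hrel⟩ := hrel B n' w (Bound.ground d₂.1) d₃ hB hn'
        ((reducible_iff_of_isGround hgF).2 hr₂)
        ((rel_iff_of_isGround hgF).2 ⟨hw, (Finset.card_le_card hwt).trans ht.card⟩) hd₃
      rw [rel_iff_of_isGround hg] at hrel
      refine ⟨r, n₃, hr, hn₃, hrel.good, ?_⟩
      rw [← cellsMod_of_isSafe hrel.good.typed hσ]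
      exact hrel.card
    obtain ⟨r, M, n₂, hr, hn₂, hrg, hcard⟩ := exists_foldCell hF hσ hstep ht.good
    refine ⟨r, n₂, .fold het hr, hn₁.trans hn₂, (rel_iff_of_isGround hg).2 ⟨hrg, ?_⟩⟩
    rw [cellsMod_of_isSafe hrg.typed hσ, Bound.ground, polyOf_mul, map_mul]
    exact hcard.trans (Nat.mul_le_mul_right _ ht.card)
  | @lower Γ e τ hτ h hs ih =>
    have hg := Ty.isGround_of_isNormal hτ
    obtain ⟨v, n₁, he, hn, hrel⟩ := ih (hθ.congr_of_sfv_eq_empty hs ∅) hd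
    rw [rel_iff_of_isGround (Ty.isGround_toSafe hg)] at hrel
    have hv : v.Good S τ n₁ := hrel.good.of_toSafe_eq (Ty.toSafe_toSafe τ).symm
    refine ⟨v, n₁, he, hn, (rel_iff_of_isGround hg).2 ⟨hv, ?_⟩⟩
    have hcard := hrel.card
    rw [cellsMod_of_isSafe hrel.good.typed (Ty.isSafe_toSafe hτ), Finset.sdiff_empty] at hcard
    rwa [cellsMod_of_isNormal hv.typed hτ]

/-! Bounds of the variables -/

section Main

variable {S : List PolyFunctor} {Γ : List Ty} {e : Tm}

theorem HasType.exists_getElem? {τ : Ty} (h : HasType S Γ e τ) :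
    ∀ x ∈ e.fv, ∃ σ, Γ[x]? = some σ := by
  induction h with
  | var hi =>
    intro x hx
    rw [Finset.mem_singleton.1 hx]
    exact ⟨_, hi⟩
  | lam _ ih => exact fun x hx => ih (x + 1) (succ_mem_iff_mem_unbind.1 hx)
  | app _ _ ih₁ ih₂ | pair _ _ _ ih₁ ih₂ | fold _ _ _ _ ih₁ ih₂ =>
    exact fun x hx => (Finset.mem_union.1 hx).elim (ih₁ x) (ih₂ x)
  | unit => simp [Tm.fv]
  | fst _ ih | snd _ ih | inl _ _ ih | inr _ _ ih | con _ _ ih | des _ _ ih | lower _ _ _ ih =>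
    exact ih
  | case _ _ _ ih ih₁ ih₂ =>
    intro x hx
    rcases Finset.mem_union.1 hx with hx | hx
    · exact ih x hx
    · rcases Finset.mem_union.1 hx with hx | hx
      · exact ih₁ (x + 1) (succ_mem_iff_mem_unbind.1 hx)
      · exact ih₂ (x + 1) (succ_mem_iff_mem_unbind.1 hx)

theorem polyOf_varBound_true (x : ℕ) : polyOf (varBound x true).1 = MvPolynomial.X x := by
  simp [varBound, Bound.ground, polyOf]

theorem polyOf_varBound_false (x : ℕ) : polyOf (varBound x false).1 = 0 := by
  simp [varBound, Bound.ground, polyOf]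

theorem reducible_varBound {σ : Ty} {x : ℕ} (hx : x ∈ e.fv) (hσ : Γ[x]? = some σ)
    (hg : σ.isGround) : Reducible (nfv Γ e) σ (varBound x σ.isNormal) := by
  rw [reducible_iff_of_isGround hg]
  cases hn : σ.isNormal with
  | true => simp [polyOf_varBound_true, nfv, hx, hσ, hn]
  | false => simp [polyOf_varBound_false]

theorem isGround_of_getElem? (hΓ : ∀ σ ∈ Γ, σ.isNormal ∨ σ.isSafe) {σ : Ty} {x : ℕ}
    (hσ : Γ[x]? = some σ) : σ.isGround :=
  (hΓ σ (List.mem_of_getElem? hσ)).elim Ty.isGround_of_isNormal Ty.isGround_of_isSafe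

theorem reducibleEnv_varBounds {τ : Ty} (hΓ : ∀ σ ∈ Γ, σ.isNormal ∨ σ.isSafe)
    (h : HasType S Γ e τ) : ReducibleEnv (nfv Γ e) Γ e.fv (varBounds 0 Γ) := by
  intro x hx
  obtain ⟨σ, hσ⟩ := h.exists_getElem? x hx
  exact ⟨σ, _, hσ, by simp [getElem?_varBounds, hσ],
    reducible_varBound hx hσ (isGround_of_getElem? hΓ hσ)⟩

theorem relEnv_varBounds (hΓ : ∀ σ ∈ Γ, σ.isNormal ∨ σ.isSafe) {θ : List Val} {n : ℕ}
    (hθ : IsEnv S Γ e θ n) : RelEnv S (nfv Γ e) (fun x => asize θ {x}) Γ e.fv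
      ((sfv Γ e).biUnion fun x => ((θ[x]?).map Val.cells).getD ∅) n θ (varBounds 0 Γ) := by
  intro x hx
  obtain ⟨σ, v, hσ, hv, ht⟩ := hθ.typed x hx
  have hg := isGround_of_getElem? hΓ hσ
  refine ⟨σ, v, _, hσ, hv, by simp [getElem?_varBounds, hσ],
    reducible_varBound hx hσ hg, (rel_iff_of_isGround hg).2 ⟨⟨ht, ?_, hθ.fresh x hx v hv⟩, ?_⟩⟩
  · exact Val.acyclic_of_shared fun a k₁ k₂ u₁ u₂ => hθ.shared x hx x hx v v hv hv a k₁ k₂ u₁ u₂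
  · cases hn : σ.isNormal with
    | true =>
      rw [cellsMod_of_isNormal ht hn, polyOf_varBound_true]
      simp [asize, hv]
    | false =>
      have hs : σ.isSafe :=
        (hΓ σ (List.mem_of_getElem? hσ)).resolve_left (by simp [hn])
      have hd : σ.deliversSafe = true := by
        by_contra hd
        simp [Ty.isNormal_of_isSafe hs (by simpa using hd)] at hn
      rw [cellsMod_of_isSafe ht hs, polyOf_varBound_false, map_zero, Nat.le_zero,
        Finset.card_eq_zero, Finset.sdiff_eq_empty_iff_subset]
      intro a ha
      exact Finset.mem_biUnion.2 ⟨x, by simp [sfv, hx, hσ, hd], by simpa [hv] using ha⟩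

end Main

end RS

theorem theorem1 :
    ∃ bound : List ℕ × List ℕ × ℕ × ℕ →. List (ℕ × List ℕ), Partrec bound ∧
      ∀ (S : List RS.PolyFunctor) (Γ : List RS.Ty) (e : RS.Tm) (τ : RS.Ty),
        RS.WfDecls S →
        (∀ σ ∈ Γ, σ.isNormal ∨ σ.isSafe) →
        τ.isGround →
        RS.HasType S Γ e τ →
        ∃ p ∈ bound (RS.judgmentCode S Γ e τ),
          (RS.polyOf p).vars ⊆ RS.nfv Γ e ∧
          ∀ (θ : List RS.Val) (n : ℕ), RS.IsEnv S Γ e θ n →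
            (∃ v n₁, RS.Eval S θ e n v n₁ ∧ v.HasTy S τ) ∧
            ∀ v n₁, RS.Eval S θ e n v n₁ →
              v.cells.card ≤
                MvPolynomial.eval (fun x => RS.asize θ {x}) (RS.polyOf p) +
                  RS.asize θ (RS.sfv Γ e) := by
  refine ⟨RS.judgmentBound, RS.partrec_judgmentBound, fun S Γ e τ _ hΓ hτ h => ?_⟩
  obtain ⟨d, hd, hr⟩ := h.exists_bound (RS.reducibleEnv_varBounds hΓ h)
  rw [RS.reducible_iff_of_isGround hτ] at hr
  refine ⟨d.1, ?_, hr, fun θ n hθ => ?_⟩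
  · rw [RS.judgmentBound_judgmentCode]
    exact Part.mem_map _ hd
  · obtain ⟨v, n₁, he, -, hrel⟩ := h.exists_eval (RS.relEnv_varBounds hΓ hθ) hd
    rw [RS.rel_iff_of_isGround hτ] at hrel
    refine ⟨⟨v, n₁, he, hrel.good.typed⟩, fun w n₂ hw => ?_⟩
    obtain ⟨rfl, -⟩ := he.unique hw
    exact (Finset.card_le_card (RS.cells_subset_cellsMod_union hrel.good.typed)).trans
      ((Finset.card_union_le _ _).trans (Nat.add_le_add_right hrel.card _))
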